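/- Let $k$ be an algebraically closed field and let $\mathcal C$ be a $k$-linear triangulated category with suspension $\Sigma$ in which idempotents split, which is Hom-finite, and which is 2-Calabi–Yau, i.e. there are bifunctorial isomorphisms $D\mathcal C(X,Y)\simeq\mathcal C(Y,\Sigma^2X)$ with $D=\mathrm{Hom}_k(?,k)$. Let $T$ be a cluster-tilting object of $\mathcal C$: $\mathcal C(T,\Sigma T)=0$, $T$ is a finite direct sum of pairwise non-isomorphic indecomposable objects, and every $X$ with $\mathcal C(T,\Sigma X)=0$ lies in $\mathrm{add}\,T$. Let $B=\mathrm{End}_{\mathcal C}(T)$, let $\mathrm{mod}\,B$ be the category of finite-dimensional right $B$-modules, and let $F=\mathcal C(T,?)$. For $X,Y\in\mathrm{mod}\,B$ put $$\langle X,Y\rangle=\dim\mathrm{Hom}_B(X,Y)-\dim\mathrm{Ext}^1_B(X,Y),\qquad \langle X,Y\rangle_a=\langle X,Y\rangle-\langle Y,X\rangle.$$ Each object $X$ of $\mathcal C$ fits into a triangle $T_1\to T_0\to X\to\Sigma T_1$ with $T_0,T_1\in\mathrm{add}\,T$; its index is $\mathrm{ind}_T(X)=[T_0]-[T_1]$ in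 the split Grothendieck group $K_0(\mathrm{add}\,T)$. For $m\in K_0(\mathrm{mod}\,B)$ define $f_{T,m}(X)=\langle F(\mathrm{ind}_T(X)),m\rangle$, where $\langle F(\cdot),\cdot\rangle$ is the biadditive pairing $K_0(\mathrm{add}\,T)\times K_0(\mathrm{mod}\,B)\to\mathbb Z$ with $([T'],[M])\mapsto\langle FT',M\rangle$. A tropical frieze on $\mathcal C$ is a function $f$ from the objects of $\mathcal C$ to $\mathbb Z$ such that $f(X)=f(Y)$ if $X\cong Y$, $f(X\oplus Y)=f(X)+f(Y)$, and $f(L)+f(M)=\max\{f(E),f(E')\}$ whenever $\dim\mathcal C(L,\Sigma M)=1$ and $L\to E\to M\to\Sigma L$, $M\to E'\to L\to\Sigma M$ are non-split triangles. Then $\langle\,,\rangle_a$ descends to a well-defined bilinear form on $K_0(\mathrm{mod}\,B)$, and for every $m\in K_0(\mathrm{mod}\,B)$: 1. if $\langle S,m\rangle_a\ge0$ for each simple $B$-module $S$, then $f_{T,m}$ is a tropical frieze on $\mathcal C$; 2. if moreover $\mathcal C$ is the cluster category of a Dynkin quiver $Q$ (type $A_n$, $D_n$, $E_6$, $E_7$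 or $E_8$), that is, the orbit category of the bounded derived category of finite-dimensional representations of $Q$ over $k$ under $\tau^{-1}\Sigma$ with a triangulated structure for which the projection is a triangle functor, and if $f_{T,m}$ is a tropical frieze, then $\langle S,m\rangle_a\ge0$ for each simple $B$-module $S$. -/

import Mathlib

open CategoryTheory Limits Pretriangulated
open scoped ModuleCat

universe w u v u' v' q r

namespace TropFrieze

/-! ### Modules over a `k`-algebra, Grothendieck groups, the Euler form -/

section Modules

variable (k : Type w) [Field k] (A : Type v) [Ring A] [Algebra k A]

/-- The `A`-modules that are finite-dimensional over `k`. -/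
def finDim : ObjectProperty (ModuleCat.{v} A) := fun M => Module.Finite k M

/-- The category of `A`-modules that are finite-dimensional over `k`. -/
abbrev FDMod := (finDim k A).FullSubcategory

/-- The relations `[M₂] - [M₁] - [M₃]`, one for each short exact sequence
`0 → M₁ → M₂ → M₃ → 0` of finite-dimensional modules. -/
def exactRelations : Set (FreeAbelianGroup (FDMod k A)) :=
  {x | ∃ M₁ M₂ M₃ : FDMod k A, ∃ (f : M₁.obj ⟶ M₂.obj) (g : M₂.obj ⟶ M₃.obj) (h : f ≫ g = 0),
    (ShortComplex.mk f g h).ShortExact ∧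
      x = FreeAbelianGroup.of M₂ - FreeAbelianGroup.of M₁ - FreeAbelianGroup.of M₃}

/-- The Grothendieck group of the abelian category of finite-dimensional `A`-modules. -/
abbrev K0Mod := FreeAbelianGroup (FDMod k A) ⧸ AddSubgroup.closure (exactRelations k A)

variable {k A}

/-- The class of a module in the Grothendieck group. -/
def K0Mod.cls (M : FDMod k A) : K0Mod k A :=
  QuotientAddGroup.mk (FreeAbelianGroup.of M)

variable (k)

/-- `⟨X, Y⟩ = dim Hom_A(X, Y) - dim Ext¹_A(X, Y)`. -/
noncomputable def euler (X Y : ModuleCat.{v} A) : ℤ :=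
  (Module.finrank k (X ⟶ Y) : ℤ) - (Module.finrank k (Abelian.Ext X Y 1) : ℤ)

/-- `⟨X, Y⟩ₐ = ⟨X, Y⟩ - ⟨Y, X⟩`. -/
noncomputable def eulerAnti (X Y : ModuleCat.{v} A) : ℤ := euler k X Y - euler k Y X

theorem finite_hom {X Y : ModuleCat.{v} A} (hX : Module.Finite k X) (hY : Module.Finite k Y) :
    Module.Finite k (X ⟶ Y) := by
  let φ : (X ⟶ Y) →ₗ[k] (X →ₗ[k] Y) :=
    { toFun := fun f => f.hom.restrictScalars k
      map_add' := fun _ _ => rfl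
      map_smul' := fun _ _ => rfl }
  refine Module.Finite.of_injective φ fun f g h => ?_
  ext x
  exact LinearMap.congr_fun h x

theorem euler_of_projective (P Y : ModuleCat.{v} A) [Projective P] :
    euler k P Y = Module.finrank k (P ⟶ Y) := by
  have : Subsingleton (Abelian.Ext P Y 1) :=
    ⟨fun a b => by
      rw [Abelian.Ext.eq_zero_of_projective a, Abelian.Ext.eq_zero_of_projective b]⟩
  rw [euler, Module.finrank_zero_of_subsingleton (R := k) (M := Abelian.Ext P Y 1)]
  simp

theorem euler_exact (P : ModuleCat.{v} A) [Projective P] (hP : Module.Finite k P)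
    {M₁ M₂ M₃ : ModuleCat.{v} A} (h₂ : Module.Finite k M₂)
    {f : M₁ ⟶ M₂} {g : M₂ ⟶ M₃} {h : f ≫ g = 0} (hS : (ShortComplex.mk f g h).ShortExact) :
    euler k P M₂ = euler k P M₁ + euler k P M₃ := by
  have hf : Mono f := hS.mono_f
  have hg : Epi g := hS.epi_g
  have := finite_hom k hP h₂
  let a := Linear.rightComp k P f
  let b := Linear.rightComp k P g
  have ha : Function.Injective a := fun x y hxy => by
    have : x ≫ f = y ≫ f := hxy
    exact (cancel_mono f).1 this
  have hb : Function.Surjective b := fun x => ⟨Projective.factorThru x g, by simp [b]⟩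
  have hab : LinearMap.range a = LinearMap.ker b := by
    ext x
    constructor
    · rintro ⟨y, rfl⟩
      simp [a, b, h]
    · intro hx
      have hx' : x ≫ g = 0 := hx
      exact ⟨hS.exact.lift x hx', hS.exact.lift_f x hx'⟩
  have e1 := LinearMap.finrank_range_add_finrank_ker b
  rw [LinearMap.range_eq_top.2 hb, finrank_top, ← hab, LinearMap.finrank_range_of_inj ha] at e1
  rw [euler_of_projective, euler_of_projective, euler_of_projective, ← e1]
  push_cast
  ring

theorem euler_biprod {P P₁ P₂ : ModuleCat.{v} A} [Projective P] [Projective P₁] [Projective P₂]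
    (h₁ : Module.Finite k P₁) (h₂ : Module.Finite k P₂) {Y : ModuleCat.{v} A}
    (hY : Module.Finite k Y) (e : P ≅ P₁ ⊞ P₂) :
    euler k P Y = euler k P₁ Y + euler k P₂ Y := by
  have := finite_hom k h₁ hY
  have := finite_hom k h₂ hY
  let φ : (P ⟶ Y) ≃ₗ[k] ((P₁ ⟶ Y) × (P₂ ⟶ Y)) :=
    { toFun := fun f => (biprod.inl ≫ e.inv ≫ f, biprod.inr ≫ e.inv ≫ f)
      invFun := fun p => e.hom ≫ biprod.desc p.1 p.2
      map_add' := fun _ _ => by simp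
      map_smul' := fun _ _ => by simp
      left_inv := fun f => by
        rw [← cancel_epi e.inv]
        apply biprod.hom_ext' <;> simp
      right_inv := fun p => by simp }
  rw [euler_of_projective, euler_of_projective, euler_of_projective, φ.finrank_eq,
    Module.finrank_prod]
  push_cast
  ring

end Modules

/-! ### Triangulated categories -/

section Additive

variable {C : Type u} [Category.{v} C] [Preadditive C] [HasFiniteBiproducts C]
  [HasBinaryBiproducts C]

/-- `add T`: the direct summands of finite direct sums of copies of `T`. -/
def addClosure (T : C) : ObjectProperty C :=
  fun X => ∃ n : ℕ, Nonempty (Retract X (⨁ fun _ : Fin n => T))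

/-- `T` is basic: it is a finite direct sum of pairwise non-isomorphic indecomposable objects. -/
def IsBasic (T : C) : Prop :=
  ∃ (n : ℕ) (S : Fin n → C), (∀ i, Indecomposable (S i)) ∧
    (∀ i j, i ≠ j → IsEmpty (S i ≅ S j)) ∧ Nonempty (T ≅ ⨁ S)

/-- The relations `[Z] - [X] - [Y]` for `Z ≅ X ⊞ Y`. -/
def splitRelations (P : ObjectProperty C) : Set (FreeAbelianGroup P.FullSubcategory) :=
  {x | ∃ X Y Z : P.FullSubcategory, Nonempty (Z.obj ≅ X.obj ⊞ Y.obj) ∧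
      x = FreeAbelianGroup.of Z - FreeAbelianGroup.of X - FreeAbelianGroup.of Y}

/-- The split Grothendieck group of a full subcategory. -/
abbrev K0Split (P : ObjectProperty C) :=
  FreeAbelianGroup P.FullSubcategory ⧸ AddSubgroup.closure (splitRelations P)

/-- The class of an object in the split Grothendieck group. -/
def K0Split.cls {P : ObjectProperty C} (X : P.FullSubcategory) : K0Split P :=
  QuotientAddGroup.mk (FreeAbelianGroup.of X)

end Additive

section Linear

variable (k : Type w) [Field k] (C : Type u) [Category.{v} C] [Preadditive C] [Linear k C]

/-- All morphism spaces are finite-dimensional. -/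
class HomFinite : Prop where
  finite : ∀ X Y : C, Module.Finite k (X ⟶ Y)

variable {C}

/-- `S` is a Serre functor: there are bifunctorial isomorphisms `D C(X, Y) ≃ C(Y, S X)`, where
`D` is the duality over `k`. -/
def IsSerreFunctor (S : C ⥤ C) : Prop :=
  ∃ e : ∀ X Y : C, Module.Dual k (X ⟶ Y) ≃ₗ[k] (Y ⟶ S.obj X),
    (∀ (X X' Y : C) (a : X ⟶ X') (φ : Module.Dual k (X ⟶ Y)),
      e X' Y (φ ∘ₗ Linear.leftComp k Y a) = e X Y φ ≫ S.map a) ∧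
    (∀ (X Y Y' : C) (b : Y' ⟶ Y) (φ : Module.Dual k (X ⟶ Y)),
      e X Y' (φ ∘ₗ Linear.rightComp k X b) = b ≫ e X Y φ)

variable (C)

/-- `C` is 2-Calabi-Yau: there are bifunctorial isomorphisms `D C(X, Y) ≃ C(Y, Σ² X)`. -/
def IsTwoCalabiYau [HasShift C ℤ] : Prop :=
  IsSerreFunctor k (shiftFunctor C (2 : ℤ))

variable {C}

/-- The functor `F = C(T, ?)` to right modules over `B = End T`, that is, to modules over the
opposite of `End T`. -/
noncomputable abbrev homFunctor (T : C) : C ⥤ ModuleCat.{v} (End T)ᵐᵒᵖ := preadditiveCoyonedaObj T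

theorem homFunctor_finite [h : HomFinite k C] (T X : C) :
    Module.Finite k ((homFunctor T).obj X) := by
  have := h.finite T X
  let φ : (T ⟶ X) →ₗ[k] ((homFunctor T).obj X) :=
    { toFun := fun f => f
      map_add' := fun _ _ => rfl
      map_smul' := fun c f => by
        change c • f = (c • 𝟙 T) ≫ f
        simp }
  exact Module.Finite.of_surjective φ fun x => ⟨x, rfl⟩

theorem homFunctor_self_projective (T : C) : Projective ((homFunctor T).obj T) := by
  refine ⟨fun {E X} f e he => ?_⟩
  obtain ⟨y, hy⟩ := (ModuleCat.epi_iff_surjective e).1 he (f.hom (𝟙 T : T ⟶ T))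
  refine ⟨ModuleCat.ofHom
    { toFun := fun g => (MulOpposite.op (show End T from g)) • y
      map_add' := fun a b => by
        rw [← add_smul]; rfl
      map_smul' := fun a b => by
        rw [RingHom.id_apply, ← mul_smul]; rfl }, ?_⟩
  apply ModuleCat.hom_ext
  apply LinearMap.ext
  intro g
  change e.hom ((MulOpposite.op (show End T from g)) • y) = f.hom g
  rw [map_smul, hy]
  refine (f.hom.map_smul (MulOpposite.op (show End T from g)) (𝟙 T : T ⟶ T)).symm.trans ?_
  exact congrArg f.hom (Category.comp_id (show T ⟶ T from g))

end Linear

section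

variable {C : Type u} [Category.{v} C] [Preadditive C] [HasFiniteBiproducts C]

theorem homFunctor_projective {T X : C} (hX : addClosure T X) :
    Projective ((homFunctor T).obj X) := by
  obtain ⟨n, ⟨ρ⟩⟩ := hX
  have := homFunctor_self_projective T
  have h : Projective ((homFunctor T).obj (⨁ fun _ : Fin n => T)) :=
    have : ∀ i : Fin n, Projective (((homFunctor T).obj ∘ fun _ : Fin n => T) i) := fun _ => this
    Projective.of_iso ((homFunctor T).mapBiproduct (fun _ : Fin n => T)).symm
      ⟨fun {E Y} f e he => ⟨biproduct.desc fun b => Projective.factorThru (biproduct.ι _ b ≫ f) e,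
        by apply biproduct.hom_ext'; intro b; simp⟩⟩
  refine ⟨fun {E Y} f e he => ?_⟩
  refine ⟨(homFunctor T).map ρ.i ≫ Projective.factorThru ((homFunctor T).map ρ.r ≫ f) e, ?_⟩
  rw [Category.assoc, Projective.factorThru_comp, ← Category.assoc, ← Functor.map_comp,
    ρ.retract, CategoryTheory.Functor.map_id, Category.id_comp]

end

section Triangulated

variable (k : Type w) [Field k] {C : Type u} [Category.{v} C] [Preadditive C] [Linear k C]
  [HasZeroObject C] [HasShift C ℤ] [∀ n : ℤ, (shiftFunctor C n).Additive] [Pretriangulated C]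

/-- Cluster-tilting objects. -/
structure IsClusterTilting (T : C) : Prop where
  rigid : ∀ f : T ⟶ T⟦(1 : ℤ)⟧, f = 0
  basic : IsBasic T
  mem_add : ∀ X : C, (∀ f : T ⟶ X⟦(1 : ℤ)⟧, f = 0) → addClosure T X

/-- Tropical friezes with values in `ℤ`. A distinguished triangle is non-split if and only if its
third morphism is non-zero, and `Ext¹(L, M) = C(L, Σ M)`. -/
structure IsTropicalFrieze (f : C → ℤ) : Prop where
  iso : ∀ X Y : C, Nonempty (X ≅ Y) → f X = f Y
  add : ∀ X Y : C, f (X ⊞ Y) = f X + f Y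
  exchange : ∀ L M : C, Module.finrank k (L ⟶ M⟦(1 : ℤ)⟧) = 1 →
    ∀ (E E' : C) (a : L ⟶ E) (b : E ⟶ M) (c : M ⟶ L⟦(1 : ℤ)⟧)
      (a' : M ⟶ E') (b' : E' ⟶ L) (c' : L ⟶ M⟦(1 : ℤ)⟧),
      Triangle.mk a b c ∈ distTriang C → c ≠ 0 →
      Triangle.mk a' b' c' ∈ distTriang C → c' ≠ 0 →
      f L + f M = max (f E) (f E')

/-- The pairing `⟨F T', m⟩` for an object `T'` of `add T`, as a function of `m` in the
Grothendieck group of finite-dimensional right `End T`-modules. -/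
noncomputable def pairingObj [HomFinite k C] (T : C) (T' : (addClosure T).FullSubcategory) :
    K0Mod k (End T)ᵐᵒᵖ →+ ℤ :=
  QuotientAddGroup.lift _ (FreeAbelianGroup.lift fun M => euler k ((homFunctor T).obj T'.obj) M.obj)
    (by
      rw [AddSubgroup.closure_le]
      rintro _ ⟨M₁, M₂, M₃, f, g, h, hS, rfl⟩
      have := homFunctor_projective T'.property
      have e := euler_exact k ((homFunctor T).obj T'.obj) (homFunctor_finite k T T'.obj)
        M₂.property hS
      simp [e])

/-- The biadditive pairing `K₀(add T) × K₀(mod B) → ℤ`, `([T'], [M]) ↦ ⟨F T', M⟩`. -/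
noncomputable def pairing [HomFinite k C] (T : C) :
    K0Split (addClosure T) →+ K0Mod k (End T)ᵐᵒᵖ →+ ℤ :=
  QuotientAddGroup.lift _ (FreeAbelianGroup.lift fun T' => pairingObj k T T')
    (by
      rw [AddSubgroup.closure_le]
      rintro _ ⟨X, Y, Z, ⟨e⟩, rfl⟩
      have h₁ := homFunctor_projective X.property
      have h₂ := homFunctor_projective Y.property
      have h₃ := homFunctor_projective Z.property
      rw [SetLike.mem_coe, AddMonoidHom.mem_ker, map_sub, map_sub, FreeAbelianGroup.lift_apply_of,
        FreeAbelianGroup.lift_apply_of, FreeAbelianGroup.lift_apply_of, sub_sub, sub_eq_zero]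
      apply QuotientAddGroup.addMonoidHom_ext
      apply FreeAbelianGroup.lift_ext
      intro M
      have := preservesBinaryBiproducts_of_preservesBiproducts (homFunctor T)
      have := euler_biprod k (homFunctor_finite k T X.obj) (homFunctor_finite k T Y.obj) M.property
        ((homFunctor T).mapIso e ≪≫ (homFunctor T).mapBiprod X.obj Y.obj)
      simpa [pairingObj] using this)

/-- Every object `X` fits into a triangle `T₁ → T₀ → X → Σ T₁` with `T₀` and `T₁` in `add T`. -/
theorem exists_index_triangle [h : HomFinite k C] {T : C} (hT : IsClusterTilting T) (X : C) :
    ∃ (T₁ T₀ : (addClosure T).FullSubcategory) (a : T₁.obj ⟶ T₀.obj) (b : T₀.obj ⟶ X)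
      (c : X ⟶ T₁.obj⟦(1 : ℤ)⟧), Triangle.mk a b c ∈ distTriang C := by
  have := h.finite T X
  let β := Module.finBasis k (T ⟶ X)
  let p : (⨁ fun _ : Fin (Module.finrank k (T ⟶ X)) => T) ⟶ X := biproduct.desc fun i => β i
  have hp : ∀ g : T ⟶ X, ∃ g', g' ≫ p = g := fun g =>
    ⟨∑ i, (β.repr g i) • biproduct.ι (fun _ : Fin (Module.finrank k (T ⟶ X)) => T) i, by
      rw [Preadditive.sum_comp]
      simp only [Linear.smul_comp, p, biproduct.ι_desc]
      exact β.sum_repr g⟩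
  obtain ⟨Z, a, c, hd⟩ := distinguished_cocone_triangle₁ p
  have hZ : addClosure T Z := by
    apply hT.mem_add
    intro f
    have h0 : f ≫ a⟦(1 : ℤ)⟧' = 0 := by
      rw [← cancel_mono ((shiftFunctor C (1 : ℤ)).mapBiproduct _).hom]
      apply biproduct.hom_ext
      intro i
      rw [zero_comp, zero_comp]
      exact hT.rigid _
    obtain ⟨f', hf'⟩ := Triangle.coyoneda_exact₁ _ hd f h0
    obtain ⟨f'', rfl⟩ := hp f'
    rw [hf']
    have h1 : p ≫ c = 0 := comp_distTriang_mor_zero₂₃ _ hd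
    change (f'' ≫ p) ≫ c = 0
    rw [Category.assoc, h1, comp_zero]
  exact ⟨⟨Z, hZ⟩, ⟨_, _, ⟨Retract.refl _⟩⟩, a, p, c, hd⟩

/-- The index `[T₀] - [T₁]` of `X` with respect to `T`, computed from any triangle
`T₁ → T₀ → X → Σ T₁` with `T₀` and `T₁` in `add T` (the result does not depend on the triangle). -/
noncomputable def index [HomFinite k C] {T : C} (hT : IsClusterTilting T) (X : C) :
    K0Split (addClosure T) :=
  K0Split.cls (exists_index_triangle k hT X).choose_spec.choose -
    K0Split.cls (exists_index_triangle k hT X).choose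

/-- The function `f_{T,m}(X) = ⟨F(ind_T X), m⟩`. -/
noncomputable def friezeFun [HomFinite k C] {T : C} (hT : IsClusterTilting T)
    (m : K0Mod k (End T)ᵐᵒᵖ) (X : C) : ℤ :=
  pairing k T (index k hT X) m

end Triangulated

/-! ### Cluster categories of Dynkin quivers -/

/-- `Q` is a Dynkin quiver: a finite quiver whose underlying graph is a Dynkin diagram of type
`Aₙ` (`n ≥ 1`), `Dₙ` (`n ≥ 4`), `E₆`, `E₇` or `E₈`, the graph being recorded by its Cartan
matrix `2 - (number of edges)`. -/
def IsDynkinQuiver (Q : Type q) [Quiver.{r} Q] : Prop :=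
  (∀ i j : Q, Finite (i ⟶ j)) ∧
  ∃ (n : ℕ) (M : Matrix (Fin n) (Fin n) ℤ) (e : Q ≃ Fin n),
    ((1 ≤ n ∧ M = CartanMatrix.A n) ∨ (4 ≤ n ∧ M = CartanMatrix.D n) ∨
      (∃ h : n = 6, M = h ▸ CartanMatrix.E₆) ∨ (∃ h : n = 7, M = h ▸ CartanMatrix.E₇) ∨
      (∃ h : n = 8, M = h ▸ CartanMatrix.E₈)) ∧
    ∀ i j : Q, M (e i) (e j) =
      (if e i = e j then 2 else 0) - (Nat.card (i ⟶ j) : ℤ) - (Nat.card (j ⟶ i) : ℤ)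

section Cluster

variable (k : Type w) [Field k] (Q : Type q) [Quiver.{r} Q]

/-- The category of finite-dimensional representations of `Q` over `k`. -/
abbrev QuiverRep := Paths Q ⥤ FGModuleCat.{w} k

noncomputable instance : HasDerivedCategory (QuiverRep k Q) := HasDerivedCategory.standard _

/-- The bounded derived category of finite-dimensional representations of `Q` over `k`. -/
abbrev BoundedDerived :=
  (DerivedCategory.TStructure.t (C := QuiverRep k Q)).bounded.FullSubcategory

end Cluster

section Orbit

variable {D : Type u'} [Category.{v'} D] {C : Type u} [Category.{v} C] {π : D ⥤ C}

/-- A functor that is invariant under `G` is invariant under the inverse of `G`. -/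
noncomputable def symmIso (G : D ≌ D) (η : G.functor ⋙ π ≅ π) : G.symm.functor ⋙ π ≅ π :=
  Functor.isoWhiskerLeft G.inverse η.symm ≪≫ (Functor.associator _ _ _).symm ≪≫
    Functor.isoWhiskerRight G.counitIso π ≪≫ π.leftUnitor

/-- A functor that is invariant under `G` is invariant under its natural powers. -/
noncomputable def powNatIso (G : D ≌ D) (η : G.functor ⋙ π ≅ π) :
    ∀ n : ℕ, (G.powNat n).functor ⋙ π ≅ π
  | 0 => π.leftUnitor
  | 1 => η
  | n + 2 => Functor.associator _ _ _ ≪≫ Functor.isoWhiskerLeft G.functor (powNatIso G η (n + 1)) ≪≫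
      η

/-- A functor that is invariant under `G` is invariant under its integral powers. -/
noncomputable def powIso (G : D ≌ D) (η : G.functor ⋙ π ≅ π) :
    ∀ n : ℤ, (G ^ n).functor ⋙ π ≅ π
  | Int.ofNat n => powNatIso G η n
  | Int.negSucc n => powNatIso G.symm (symmIso G η) (n + 1)

/-- The map `⨁ₙ D(X, Gⁿ Y) → C(π X, π Y)` induced by `π` and by the isomorphisms
`π Gⁿ Y ≅ π Y`. -/
noncomputable def orbitMap [Preadditive D] [Preadditive C] [π.Additive] (G : D ≌ D)
    (η : G.functor ⋙ π ≅ π) (X Y : D) :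
    (DirectSum ℤ fun n => (X ⟶ (G ^ n).functor.obj Y)) →+ (π.obj X ⟶ π.obj Y) :=
  DirectSum.toAddMonoid fun n =>
    { toFun := fun f => π.map f ≫ (powIso G η n).hom.app Y
      map_zero' := by simp
      map_add' := fun _ _ => by simp }

end Orbit

section ClusterCategory

variable (k : Type w) [Field k] (Q : Type q) [Quiver.{r} Q]
  (C : Type u) [Category.{v} C] [Preadditive C] [Linear k C]
  [HasZeroObject C] [HasShift C ℤ] [∀ n : ℤ, (shiftFunctor C n).Additive] [Pretriangulated C]

/-- Data identifying the triangulated category `C` with the cluster category of `Q`, the orbit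
category of the bounded derived category `D` of representations of `Q` under `τ⁻¹ Σ`: an
Auslander-Reiten translation `τ` of `D` (`τ Σ` is a Serre functor) and a `k`-linear triangle
functor `π : D ⥤ C`, invariant under `G = τ⁻¹ Σ`, that is surjective on isomorphism classes of
objects and induces bijections `⨁ₙ D(X, Gⁿ Y) → C(π X, π Y)`. -/
structure ClusterCategoryData where
  τ : BoundedDerived k Q ≌ BoundedDerived k Q
  serre : IsSerreFunctor k (τ.functor ⋙ shiftFunctor (BoundedDerived k Q) (1 : ℤ))
  π : BoundedDerived k Q ⥤ C
  [additive : π.Additive]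
  [linear : π.Linear k]
  [commShift : π.CommShift ℤ]
  [triangulated : π.IsTriangulated]
  η : (τ.symm.trans (shiftEquiv (BoundedDerived k Q) (1 : ℤ))).functor ⋙ π ≅ π
  essSurj : π.EssSurj
  bijective : ∀ X Y : BoundedDerived k Q, Function.Bijective
    (orbitMap (τ.symm.trans (shiftEquiv (BoundedDerived k Q) (1 : ℤ))) η X Y)

/-- `C` is the cluster category of `Q` over `k`. -/
def IsClusterCategory : Prop := Nonempty (ClusterCategoryData k Q C)

end ClusterCategory

end TropFrieze

/-!
Write `F = C(T, ?)`, and call a morphism `f` *killed* by `T` if `F f = 0`. By the defining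
properties of `T` these are the morphisms factoring through `Σ (add T)`.

*The index pairing.* For a triangle `T₁ → T₀ → X → Σ T₁` with `T₀`, `T₁` in `add T`, the map
`Hom(F T₀, F Y) → Hom(F T₁, F Y)` has kernel `Hom(F X, F Y)`, and its cokernel is the space of
morphisms `X → Σ Y` killed by `T`. Hence `f_{T,[F Y]}(X)` is the difference of the two dimensions
(`IndexTriangle.finrank_sub_finrank`). The same presentation identifies `Ext¹(F X, F Y)` with the
space of morphisms `X → Σ Y` killed by both `T` and `Σ T` (`finrank_ext_homFunctor`).

*The form.* The 2-Calabi-Yau duality `D C(X, Σ Y) ≃ C(Y, Σ X)` exchanges the space of morphisms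
killed by `T` with the orthogonal of its counterpart, and likewise for `Σ T`. As
`dim (U ∩ V) - dim (U + V)^⊥ = dim U + dim V - dim C(X, Σ Y)`, all `Ext¹` terms of the
antisymmetrized Euler form can be computed, and the outcome is
`⟨F Σ Z, M⟩ₐ = f_{T,[M]}(Σ Z) + f_{T,[M]}(Z)` (`eulerAnti_homFunctor_shift`). The right-hand side
is additive in `M` and every module is some `F Σ Z`, so the form descends to the Grothendieck group
(`exists_eulerAntiForm`).

*Triangles.* On a triangle `L → E → M → Σ L` with third morphism `ε`, the pairing `f = f_{T,m}`
satisfies `f(L) + f(M) - f(E) = ⟨im F ε, m⟩ₐ` (`friezeHom_add_eq_form`). For `F ε = 0` this is a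
six-term exact sequence (`friezeHom_add_of_killed`), to which the general case is reduced by the
octahedral axiom (`friezeHom_add_eq`).

*Sufficiency.* If `⟨S, m⟩ₐ ≥ 0` for the simple modules `S`, this holds for all modules, so
`f(L) + f(M) ≥ f(E)` always. If `dim C(L, Σ M) = 1`, the duality shows that exactly one of the two
spaces `C(L, Σ M)` and `C(M, Σ L)` is killed by `T`, so that equality holds for one of the two
exchange triangles (`isTropicalFrieze_of_nonneg`).

*Necessity.* Write a simple module as `S = F Σ Z` and let `P` be the indecomposable summand of `T`
such that `F P` covers `S`. Since `k` is algebraically closed, `C(P, Σ Z)` is one-dimensional, and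
so is its dual `C(Z, Σ P)`. A nonzero `ε : P → Σ Z` has `im F ε = S`, so the exchange relation
for `Z` and `P` gives `⟨S, m⟩ₐ = f(Z) + f(P) - f(E) ≥ 0` (`nonneg_of_isTropicalFrieze`).
-/

namespace TropFrieze

/-! ### Morphisms killed by a test object -/

section Killed

variable (k : Type w) [Field k] {C : Type u} [Category.{v} C] [Preadditive C] [Linear k C]

/-- The morphisms `A ⟶ B` whose composites with all morphisms `W ⟶ A` vanish, that is, the kernel
of `C(A, B) → Hom(C(W, A), C(W, B))`. -/
def killed (W A B : C) : Submodule k (A ⟶ B) where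
  carrier := {f | ∀ t : W ⟶ A, t ≫ f = 0}
  zero_mem' := fun _ => comp_zero
  add_mem' := fun hf hg t => by rw [Preadditive.comp_add, hf t, hg t, add_zero]
  smul_mem' := fun c f hf t => by rw [Linear.comp_smul, hf t, smul_zero]

variable {k} in
theorem mem_killed {W A B : C} {f : A ⟶ B} : f ∈ killed k W A B ↔ ∀ t : W ⟶ A, t ≫ f = 0 :=
  Iff.rfl

/-- The action of the functor `C(T, ?)` on morphisms, as a linear map. -/
noncomputable def homFunctorMap (T X Y : C) :
    (X ⟶ Y) →ₗ[k] ((homFunctor T).obj X ⟶ (homFunctor T).obj Y) where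
  toFun f := (homFunctor T).map f
  map_add' _ _ := (homFunctor T).map_add
  map_smul' c f := by
    apply ModuleCat.hom_ext
    apply LinearMap.ext
    have h : ∀ t : T ⟶ X, t ≫ (c • f) = (c • 𝟙 T) ≫ t ≫ f := by simp
    exact h

theorem homFunctor_map_eq_zero_iff (T : C) {X Y : C} (f : X ⟶ Y) :
    (homFunctor T).map f = 0 ↔ f ∈ killed k T X Y :=
  ⟨fun h t => congrArg (fun φ => φ.hom t) h, fun h => by
    apply ModuleCat.hom_ext
    apply LinearMap.ext
    exact h⟩

theorem ker_homFunctorMap (T X Y : C) :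
    LinearMap.ker (homFunctorMap k T X Y) = killed k T X Y := by
  ext f
  exact homFunctor_map_eq_zero_iff k T f

end Killed

section AddClosure

variable {C : Type u} [Category.{v} C] [Preadditive C] [HasFiniteBiproducts C]

theorem addClosure_self (T : C) : addClosure T T :=
  ⟨1, ⟨{ i := biproduct.ι (fun _ : Fin 1 => T) 0, r := biproduct.π (fun _ : Fin 1 => T) 0 }⟩⟩

theorem comp_eq_zero_of_addClosure {T W X Y : C} (hW : addClosure T W) {f : X ⟶ Y}
    (hf : ∀ t : T ⟶ X, t ≫ f = 0) (g : W ⟶ X) : g ≫ f = 0 := by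
  obtain ⟨n, ⟨ρ⟩⟩ := hW
  have h : (ρ.r ≫ g) ≫ f = 0 := by
    apply biproduct.hom_ext'
    intro i
    rw [comp_zero, ← Category.assoc, hf]
  rw [← Category.id_comp g, ← ρ.retract, Category.assoc, Category.assoc, ← Category.assoc ρ.r g f,
    h, comp_zero]

/-- The test object `G T` may be replaced by any object of `G (add T)`, for an additive `G`. -/
theorem comp_eq_zero_of_addClosure_map {T W : C} (hW : addClosure T W) (G : C ⥤ C) [G.Additive]
    {X Y : C} {f : X ⟶ Y} (hf : ∀ t : G.obj T ⟶ X, t ≫ f = 0) (g : G.obj W ⟶ X) : g ≫ f = 0 := by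
  obtain ⟨n, ⟨ρ⟩⟩ := hW
  have h : (G.map ρ.r ≫ g) ≫ f = 0 := by
    rw [← cancel_epi (G.mapBiproduct _).inv]
    apply biproduct.hom_ext'
    intro i
    rw [comp_zero, comp_zero, ← Category.assoc, ← Category.assoc, hf]
  rw [← Category.id_comp g, ← G.map_id, ← ρ.retract, G.map_comp, Category.assoc, Category.assoc,
    ← Category.assoc (G.map ρ.r) g f, h, comp_zero]

theorem eq_zero_of_addClosure_map {T W : C} (hW : addClosure T W) (G : C ⥤ C) [G.Additive]
    {A : C} (h : ∀ f : A ⟶ G.obj T, f = 0) (f : A ⟶ G.obj W) : f = 0 := by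
  obtain ⟨n, ⟨ρ⟩⟩ := hW
  have h : f ≫ G.map ρ.i = 0 := by
    rw [← cancel_mono (G.mapBiproduct _).hom]
    apply biproduct.hom_ext
    intro i
    rw [zero_comp, zero_comp]
    exact h _
  rw [← Category.comp_id f, ← G.map_id, ← ρ.retract, G.map_comp, ← Category.assoc, h, zero_comp]

/-- A morphism of modules out of `C(T, W)`, with `W` in `add T`, comes from a unique morphism
of `C`: this is the Yoneda lemma for `W = T`. -/
theorem homFunctor_map_bijective_of_addClosure {T W : C} (hW : addClosure T W) (Y : C) :
    Function.Bijective
      (fun f : W ⟶ Y => ((homFunctor T).map f : (homFunctor T).obj W ⟶ (homFunctor T).obj Y)) := by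
  have hT : ∀ φ : (homFunctor T).obj T ⟶ (homFunctor T).obj Y,
      ∃ y : T ⟶ Y, (homFunctor T).map y = φ := by
    intro φ
    refine ⟨φ.hom (𝟙 T : T ⟶ T), ?_⟩
    apply ModuleCat.hom_ext
    apply LinearMap.ext
    intro t
    refine (φ.hom.map_smul (MulOpposite.op (show End T from t)) (𝟙 T : T ⟶ T)).symm.trans ?_
    exact congrArg φ.hom (Category.comp_id (show T ⟶ T from t))
  constructor
  · intro f g hfg
    rw [← sub_eq_zero]
    have h : ∀ t : T ⟶ W, t ≫ (f - g) = 0 := fun t => by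
      rw [Preadditive.comp_sub, sub_eq_zero]
      exact congrArg (fun φ => φ.hom t) hfg
    simpa using comp_eq_zero_of_addClosure hW h (𝟙 W)
  · intro φ
    obtain ⟨n, ⟨ρ⟩⟩ := hW
    let ι := biproduct.ι (fun _ : Fin n => T)
    choose y hy using fun i => hT ((homFunctor T).map (ι i) ≫ (homFunctor T).map ρ.r ≫ φ)
    refine ⟨ρ.i ≫ biproduct.desc y, ?_⟩
    have key : (homFunctor T).map (biproduct.desc y) = (homFunctor T).map ρ.r ≫ φ := by
      rw [← cancel_epi ((homFunctor T).mapBiproduct (fun _ : Fin n => T)).inv]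
      apply biproduct.hom_ext'
      intro i
      rw [Functor.mapBiproduct_inv, biproduct.ι_desc_assoc, biproduct.ι_desc_assoc,
        ← Functor.map_comp, biproduct.ι_desc]
      exact hy i
    change (homFunctor T).map _ = φ
    rw [Functor.map_comp, key, ← Category.assoc, ← Functor.map_comp, ρ.retract,
      CategoryTheory.Functor.map_id, Category.id_comp]

/-- The linear isomorphism `C(W, Y) ≃ Hom(C(T, W), C(T, Y))` for `W` in `add T`. -/
noncomputable def homFunctorEquiv (k : Type w) [Field k] [Linear k C] {T W : C}
    (hW : addClosure T W) (Y : C) :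
    (W ⟶ Y) ≃ₗ[k] ((homFunctor T).obj W ⟶ (homFunctor T).obj Y) :=
  LinearEquiv.ofBijective (homFunctorMap k T W Y) (homFunctor_map_bijective_of_addClosure hW Y)

end AddClosure

/-! ### Exactness of a distinguished triangle -/

section Exactness

variable {C : Type u} [Category.{v} C] [Preadditive C]
  [HasZeroObject C] [HasShift C ℤ] [∀ n : ℤ, (shiftFunctor C n).Additive] [Pretriangulated C]
  {A B D Y : C} {f : A ⟶ B} {g : B ⟶ D} {h : D ⟶ A⟦(1 : ℤ)⟧}
  (H : Triangle.mk f g h ∈ distTriang C)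

include H

theorem dist_comp₁₂ : f ≫ g = 0 := comp_distTriang_mor_zero₁₂ _ H

theorem dist_comp₂₃ : g ≫ h = 0 := comp_distTriang_mor_zero₂₃ _ H

theorem dist_comp₃₁ : h ≫ f⟦(1 : ℤ)⟧' = 0 := comp_distTriang_mor_zero₃₁ _ H

theorem dist_desc₂ (u : B ⟶ Y) (hu : f ≫ u = 0) : ∃ v : D ⟶ Y, u = g ≫ v :=
  Triangle.yoneda_exact₂ _ H u hu

theorem dist_desc₃ (u : D ⟶ Y) (hu : g ≫ u = 0) : ∃ v : A⟦(1 : ℤ)⟧ ⟶ Y, u = h ≫ v :=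
  Triangle.yoneda_exact₃ _ H u hu

theorem dist_desc₁ (u : A ⟶ Y) (hu : h ≫ u⟦(1 : ℤ)⟧' = 0) : ∃ v : B ⟶ Y, u = f ≫ v := by
  obtain ⟨v, hv⟩ := Triangle.yoneda_exact₃ _ (rot_of_distTriang _ H) (u⟦(1 : ℤ)⟧') hu
  obtain ⟨w, rfl⟩ : ∃ w : B ⟶ Y, w⟦(1 : ℤ)⟧' = v := (shiftFunctor C (1 : ℤ)).map_surjective v
  refine ⟨-w, (shiftFunctor C (1 : ℤ)).map_injective ?_⟩
  refine hv.trans ?_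
  change (-f⟦(1 : ℤ)⟧') ≫ w⟦(1 : ℤ)⟧' = _
  simp

theorem dist_lift₁ (u : Y ⟶ A⟦(1 : ℤ)⟧) (hu : u ≫ f⟦(1 : ℤ)⟧' = 0) : ∃ v : Y ⟶ D, u = v ≫ h :=
  Triangle.coyoneda_exact₁ _ H u hu

theorem dist_lift₂ (u : Y ⟶ B) (hu : u ≫ g = 0) : ∃ v : Y ⟶ A, u = v ≫ f :=
  Triangle.coyoneda_exact₂ _ H u hu

theorem dist_lift₃ (u : Y ⟶ D) (hu : u ≫ h = 0) : ∃ v : Y ⟶ B, u = v ≫ g :=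
  Triangle.coyoneda_exact₃ _ H u hu

end Exactness

/-! ### Index triangles -/

section Index

variable (k : Type w) [Field k] {C : Type u} [Category.{v} C] [Preadditive C] [Linear k C]
  [HasZeroObject C] [HasShift C ℤ] [∀ n : ℤ, (shiftFunctor C n).Additive] [Pretriangulated C]

/-- A triangle `T₁ → T₀ → X → Σ T₁` with `T₀` and `T₁` in `add T`, as in the definition of the
index. -/
structure IndexTriangle (T X : C) where
  T₁ : C
  T₀ : C
  a : T₁ ⟶ T₀
  b : T₀ ⟶ X
  c : X ⟶ T₁⟦(1 : ℤ)⟧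
  h₁ : addClosure T T₁
  h₀ : addClosure T T₀
  dist : Triangle.mk a b c ∈ distTriang C

variable {k} {T X Y : C}

theorem IsClusterTilting.rigid_add (hT : IsClusterTilting T) {W : C} (hW : addClosure T W)
    (f : T ⟶ W⟦(1 : ℤ)⟧) : f = 0 :=
  eq_zero_of_addClosure_map hW (shiftFunctor C (1 : ℤ)) hT.rigid f

namespace IndexTriangle

variable (τ : IndexTriangle T X) (hT : IsClusterTilting T)

theorem a_b : τ.a ≫ τ.b = 0 := dist_comp₁₂ τ.dist

theorem b_c : τ.b ≫ τ.c = 0 := dist_comp₂₃ τ.dist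

theorem c_shift_a : τ.c ≫ τ.a⟦(1 : ℤ)⟧' = 0 := dist_comp₃₁ τ.dist

include hT in
theorem comp_c (t : T ⟶ X) : t ≫ τ.c = 0 := hT.rigid_add τ.h₁ _

include hT in
theorem exists_lift (t : T ⟶ X) : ∃ s : T ⟶ τ.T₀, t = s ≫ τ.b :=
  dist_lift₃ τ.dist t (τ.comp_c hT t)

include hT in
theorem epi_map_b : Epi ((homFunctor T).map τ.b) := by
  rw [ModuleCat.epi_iff_surjective]
  intro t
  obtain ⟨s, hs⟩ := τ.exists_lift hT t
  exact ⟨s, hs.symm⟩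

theorem b_comp_eq_zero_iff (hT : IsClusterTilting T) {f : X ⟶ Y} :
    τ.b ≫ f = 0 ↔ f ∈ killed k T X Y := by
  constructor
  · intro h t
    obtain ⟨s, rfl⟩ := τ.exists_lift hT t
    rw [Category.assoc, h, comp_zero]
  · intro h
    exact comp_eq_zero_of_addClosure τ.h₀ h _

/-- The morphisms `X ⟶ Y` killed by `T` are those factoring through `X ⟶ Σ T₁`. -/
theorem mem_killed_iff (hT : IsClusterTilting T) {f : X ⟶ Y} :
    f ∈ killed k T X Y ↔ ∃ g : τ.T₁⟦(1 : ℤ)⟧ ⟶ Y, f = τ.c ≫ g := by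
  rw [← τ.b_comp_eq_zero_iff hT]
  constructor
  · exact dist_desc₃ τ.dist f
  · rintro ⟨g, rfl⟩
    rw [← Category.assoc, τ.b_c, zero_comp]

include τ hT in
theorem homFunctor_map_surjective (Y : C) :
    Function.Surjective
      (fun f : X ⟶ Y => ((homFunctor T).map f : (homFunctor T).obj X ⟶ (homFunctor T).obj Y)) := by
  intro φ
  obtain ⟨g, hg⟩ := (homFunctor_map_bijective_of_addClosure τ.h₀ Y).2 ((homFunctor T).map τ.b ≫ φ)
  have h : τ.a ≫ g = 0 := by
    apply (homFunctor_map_bijective_of_addClosure τ.h₁ Y).1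
    change (homFunctor T).map _ = (homFunctor T).map _
    change (homFunctor T).map _ = _ at hg
    rw [Functor.map_comp, hg, ← Category.assoc, ← Functor.map_comp, τ.a_b, Functor.map_zero,
      zero_comp, Functor.map_zero]
  obtain ⟨f, hf⟩ := dist_desc₂ τ.dist g h
  refine ⟨f, ?_⟩
  have := τ.epi_map_b hT
  rw [← cancel_epi ((homFunctor T).map τ.b), ← hg]
  change _ ≫ (homFunctor T).map f = (homFunctor T).map _
  rw [← Functor.map_comp, hf]

/-- `a ≫ ?` and `c ≫ Σ ?` form an exact sequence `C(T₀, Y) → C(T₁, Y) → C(X, Σ Y)`. -/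
theorem c_comp_shift_eq_zero_iff {g : τ.T₁ ⟶ Y} :
    τ.c ≫ g⟦(1 : ℤ)⟧' = 0 ↔ ∃ g' : τ.T₀ ⟶ Y, τ.a ≫ g' = g := by
  constructor
  · intro h
    obtain ⟨g', rfl⟩ := dist_desc₁ τ.dist g h
    exact ⟨g', rfl⟩
  · rintro ⟨g', rfl⟩
    rw [Functor.map_comp, ← Category.assoc, τ.c_shift_a, zero_comp]

end IndexTriangle

theorem exists_indexTriangle (k : Type w) [Field k] [Linear k C] [HomFinite k C]
    (hT : IsClusterTilting T) (X : C) :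
    Nonempty (IndexTriangle T X) := by
  obtain ⟨T₁, T₀, a, b, c, h⟩ := exists_index_triangle k hT X
  exact ⟨⟨_, _, a, b, c, T₁.property, T₀.property, h⟩⟩

end Index

/-! ### The Euler form in terms of projective presentations -/

section ExtDim

variable (k : Type w) [Field k] {A : Type v} [Ring A] [Algebra k A]

/-- `Ext¹(M, N)` is the cokernel of `Hom(P, N) → Hom(K, N)` for a short exact sequence
`0 → K → P → M → 0` with `P` projective. -/
theorem finrank_ext_eq_finrank_range {K P M : ModuleCat.{v} A} [Projective P] {i : K ⟶ P}
    {p : P ⟶ M} {h : i ≫ p = 0} (hS : (ShortComplex.mk i p h).ShortExact) (N : ModuleCat.{v} A)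
    {V : Type*} [AddCommGroup V] [Module k V] (ψ : (K ⟶ N) →ₗ[k] V)
    (hψ : ∀ x, ψ x = 0 ↔ ∃ y, i ≫ y = x) :
    Module.finrank k (Abelian.Ext M N 1) = Module.finrank k (LinearMap.range ψ) := by
  let δ : (K ⟶ N) →ₗ[k] Abelian.Ext M N 1 :=
    { toFun := fun x => hS.extClass.comp (Abelian.Ext.mk₀ x) (add_zero 1)
      map_add' := fun x y => by rw [Abelian.Ext.mk₀_add, Abelian.Ext.comp_add]
      map_smul' := fun c x => by
        rw [Abelian.Ext.mk₀_smul, Abelian.Ext.comp_smul, RingHom.id_apply] }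
  have hδ : ∀ x, δ x = 0 ↔ ∃ y, i ≫ y = x := by
    intro x
    constructor
    · intro hx
      obtain ⟨y, hy⟩ := Abelian.Ext.contravariant_sequence_exact₁ hS N (Abelian.Ext.mk₀ x)
        (add_zero 1) hx
      obtain ⟨y, rfl⟩ := Abelian.Ext.addEquiv₀.symm.surjective y
      exact ⟨y, Abelian.Ext.addEquiv₀.symm.injective (by simpa using hy)⟩
    · rintro ⟨y, rfl⟩
      change hS.extClass.comp (Abelian.Ext.mk₀ (i ≫ y)) (add_zero 1) = 0
      rw [← Abelian.Ext.mk₀_comp_mk₀, ← Abelian.Ext.comp_assoc_of_second_deg_zero]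
      have := hS.extClass_comp
      dsimp at this
      rw [this, Abelian.Ext.zero_comp]
  have hsurj : Function.Surjective δ := by
    intro x
    obtain ⟨y, hy⟩ := Abelian.Ext.contravariant_sequence_exact₃ hS N x
      (Abelian.Ext.eq_zero_of_projective _) (add_zero 1)
    obtain ⟨y, rfl⟩ := Abelian.Ext.addEquiv₀.symm.surjective y
    exact ⟨y, hy⟩
  have hker : LinearMap.ker δ = LinearMap.ker ψ := by
    ext x
    exact (hδ x).trans (hψ x).symm
  rw [← (δ.quotKerEquivOfSurjective hsurj).finrank_eq, hker, ψ.quotKerEquivRange.finrank_eq]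

theorem euler_congr {X X' Y Y' : ModuleCat.{v} A} (e : X ≅ X') (f : Y ≅ Y') :
    euler k X Y = euler k X' Y' := by
  let φ : Abelian.Ext X Y 1 ≃ₗ[k] Abelian.Ext X' Y' 1 :=
    { toFun := fun x => (Abelian.Ext.mk₀ e.inv).comp (x.comp (Abelian.Ext.mk₀ f.hom) (add_zero 1))
        (zero_add 1)
      invFun := fun x => (Abelian.Ext.mk₀ e.hom).comp
        (x.comp (Abelian.Ext.mk₀ f.inv) (add_zero 1)) (zero_add 1)
      map_add' := fun x y => by simp
      map_smul' := fun c x => by simp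
      left_inv := fun x => by simp
      right_inv := fun x => by simp }
  rw [euler, euler, φ.finrank_eq, (Linear.homCongr k e f).finrank_eq]

end ExtDim

section Dimensions

instance finite_hom_of_homFinite (k : Type w) [Field k] {C : Type u} [Category.{v} C]
    [Preadditive C] [Linear k C] [h : HomFinite k C] (X Y : C) : Module.Finite k (X ⟶ Y) :=
  h.finite X Y

variable (k : Type w) [Field k] {C : Type u} [Category.{v} C] [Preadditive C] [Linear k C]
  [HasZeroObject C] [HasShift C ℤ] [∀ n : ℤ, (shiftFunctor C n).Additive]
  [Pretriangulated C] [HomFinite k C]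

variable {T : C} (hT : IsClusterTilting T)

include k hT

theorem homFunctor_map_surjective {X Y : C} (φ : (homFunctor T).obj X ⟶ (homFunctor T).obj Y) :
    ∃ f : X ⟶ Y, (homFunctor T).map f = φ := by
  obtain ⟨τ⟩ := exists_indexTriangle k hT X
  exact τ.homFunctor_map_surjective hT Y φ

theorem finrank_hom_homFunctor (X Y : C) :
    Module.finrank k ((homFunctor T).obj X ⟶ (homFunctor T).obj Y) +
      Module.finrank k (killed k T X Y) = Module.finrank k (X ⟶ Y) := by
  rw [← ker_homFunctorMap, ← LinearMap.finrank_range_add_finrank_ker (homFunctorMap k T X Y),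
    LinearMap.range_eq_top.2 fun φ => homFunctor_map_surjective k hT φ, finrank_top]

variable [∀ n : ℤ, (shiftFunctor C n).Linear k]

omit hT [HomFinite k C] in
variable {k} in
/-- The map `C(T₁, Y) → C(X, Σ Y)` attached to a morphism `c : X ⟶ Σ T₁`. -/
noncomputable def compShift {X W : C} (c : X ⟶ W⟦(1 : ℤ)⟧) (Y : C) :
    (W ⟶ Y) →ₗ[k] (X ⟶ Y⟦(1 : ℤ)⟧) :=
  Linear.leftComp k _ c ∘ₗ (shiftFunctor C (1 : ℤ)).mapLinearMap k

/-- The Euler characteristic of `Hom(F T₀, F Y) → Hom(F T₁, F Y)` for a triangle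
`T₁ → T₀ → X → Σ T₁`: the kernel is `Hom(F X, F Y)`, and the cokernel is the space of
morphisms `X ⟶ Σ Y` killed by `T`. -/
theorem IndexTriangle.finrank_sub_finrank {X : C} (τ : IndexTriangle T X) (Y : C) :
    (Module.finrank k (τ.T₀ ⟶ Y) : ℤ) - Module.finrank k (τ.T₁ ⟶ Y) =
      Module.finrank k ((homFunctor T).obj X ⟶ (homFunctor T).obj Y) -
        Module.finrank k (killed k T X (Y⟦(1 : ℤ)⟧)) := by
  let α := Linear.leftComp k Y τ.a
  let β := Linear.leftComp k Y τ.b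
  let γ := compShift (k := k) τ.c Y
  have hβ : LinearMap.ker β = killed k T X Y := by
    ext f
    exact τ.b_comp_eq_zero_iff hT
  have hα : LinearMap.ker α = LinearMap.range β := by
    ext f
    constructor
    · intro hf
      obtain ⟨g, rfl⟩ := dist_desc₂ τ.dist f hf
      exact ⟨g, rfl⟩
    · rintro ⟨g, rfl⟩
      change τ.a ≫ τ.b ≫ g = 0
      rw [← Category.assoc, τ.a_b, zero_comp]
  have hγ : LinearMap.ker γ = LinearMap.range α := by
    ext g
    exact τ.c_comp_shift_eq_zero_iff
  have hγ' : LinearMap.range γ = killed k T X (Y⟦(1 : ℤ)⟧) := by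
    ext f
    rw [τ.mem_killed_iff hT]
    constructor
    · rintro ⟨g, rfl⟩
      exact ⟨g⟦(1 : ℤ)⟧', rfl⟩
    · rintro ⟨g, rfl⟩
      obtain ⟨g, rfl⟩ := (shiftFunctor C (1 : ℤ)).map_surjective g
      exact ⟨g, rfl⟩
  have e1 := LinearMap.finrank_range_add_finrank_ker α
  have e2 := LinearMap.finrank_range_add_finrank_ker β
  have e3 := LinearMap.finrank_range_add_finrank_ker γ
  have e4 := finrank_hom_homFunctor k hT X Y
  rw [hα] at e1
  rw [hβ] at e2
  rw [hγ, hγ'] at e3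
  omega

/-- `Ext¹(F X, F Y)` is the space of morphisms `f : X ⟶ Σ Y` with `F f = 0` and
`F (Σ⁻¹ f) = 0`: these are the triangles `Y → E → X → Σ Y` that `F` maps to short exact
sequences. -/
theorem finrank_ext_homFunctor (X Y : C) :
    Module.finrank k (Abelian.Ext ((homFunctor T).obj X) ((homFunctor T).obj Y) 1) =
      Module.finrank k ((killed k T X (Y⟦(1 : ℤ)⟧) ⊓
        killed k (T⟦(1 : ℤ)⟧) X (Y⟦(1 : ℤ)⟧) : Submodule k (X ⟶ Y⟦(1 : ℤ)⟧))) := by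
  obtain ⟨τ⟩ := exists_indexTriangle k hT X
  have := homFunctor_projective τ.h₀
  have := τ.epi_map_b hT
  let p := (homFunctor T).map τ.b
  let i := kernel.ι p
  have hS : (ShortComplex.mk i p (kernel.condition p)).ShortExact :=
    { exact := ShortComplex.exact_of_f_is_kernel _ (kernelIsKernel p) }
  let q := kernel.lift p ((homFunctor T).map τ.a) (by
    rw [← Functor.map_comp, τ.a_b, Functor.map_zero])
  have hq : q ≫ i = (homFunctor T).map τ.a := kernel.lift_ι _ _ _
  have hqi : ∀ t : T ⟶ τ.T₁, q.hom t = 0 ↔ t ≫ τ.a = 0 := by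
    intro t
    have h1 : i.hom (q.hom t) = t ≫ τ.a := congrArg (fun φ => φ.hom t) hq
    rw [← h1]
    constructor
    · intro h
      rw [h]
      exact map_zero i.hom
    · intro h
      exact (ModuleCat.mono_iff_injective i).1 inferInstance (h.trans (map_zero i.hom).symm)
  have hqepi : Epi q := by
    rw [ModuleCat.epi_iff_surjective]
    intro z
    have h1 : (show T ⟶ τ.T₀ from i.hom z) ≫ τ.b = 0 :=
      congrArg (fun φ => φ.hom z) (kernel.condition p)
    obtain ⟨t, ht⟩ := dist_lift₂ τ.dist _ h1
    refine ⟨t, (ModuleCat.mono_iff_injective i).1 inferInstance ?_⟩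
    exact (congrArg (fun φ => φ.hom t) hq).trans ht.symm
  let ε := homFunctorEquiv k τ.h₁ Y
  let ψ : (kernel p ⟶ (homFunctor T).obj Y) →ₗ[k] (X ⟶ Y⟦(1 : ℤ)⟧) :=
    compShift τ.c Y ∘ₗ ε.symm.toLinearMap ∘ₗ Linear.leftComp k _ q
  have hε : ∀ x, (homFunctor T).map (ε.symm x) = x := fun x => ε.apply_symm_apply x
  have hψ' : ∀ x, ψ x = τ.c ≫ (ε.symm (q ≫ x))⟦(1 : ℤ)⟧' := fun x => rfl
  have hψ : ∀ x, ψ x = 0 ↔ ∃ y, i ≫ y = x := by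
    intro x
    rw [hψ', τ.c_comp_shift_eq_zero_iff]
    constructor
    · rintro ⟨g, hg⟩
      refine ⟨(homFunctor T).map g, ?_⟩
      rw [← cancel_epi q, ← Category.assoc, hq, ← Functor.map_comp, hg, hε]
    · rintro ⟨y, rfl⟩
      refine ⟨(homFunctorEquiv k τ.h₀ Y).symm y, ?_⟩
      apply ε.injective
      change (homFunctor T).map _ = _
      rw [LinearEquiv.apply_symm_apply, Functor.map_comp, ← Category.assoc, hq]
      congr 1
      exact (homFunctorEquiv k τ.h₀ Y).apply_symm_apply y
  rw [finrank_ext_eq_finrank_range k hS _ ψ hψ]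
  have hrange : LinearMap.range ψ = killed k T X (Y⟦(1 : ℤ)⟧) ⊓
        killed k (T⟦(1 : ℤ)⟧) X (Y⟦(1 : ℤ)⟧) := by
    apply le_antisymm
    · rintro _ ⟨x, rfl⟩
      rw [hψ']
      refine ⟨(τ.mem_killed_iff hT).2 ⟨_, rfl⟩, fun s => ?_⟩
      obtain ⟨t, ht⟩ : ∃ t : T ⟶ τ.T₁, t⟦(1 : ℤ)⟧' = s ≫ τ.c :=
        (shiftFunctor C (1 : ℤ)).map_surjective (s ≫ τ.c)
      have h1 : t ≫ τ.a = 0 := by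
        apply (shiftFunctor C (1 : ℤ)).map_injective
        rw [Functor.map_comp, ht, Category.assoc, τ.c_shift_a, comp_zero, Functor.map_zero]
      have h2 : t ≫ ε.symm (q ≫ x) = 0 := by
        have h3 : t ≫ ε.symm (q ≫ x) = x.hom (q.hom t) :=
          congrArg (fun φ => φ.hom t) (hε (q ≫ x))
        rw [h3, (hqi t).2 h1]
        exact map_zero x.hom
      rw [← Category.assoc, ← ht, ← Functor.map_comp, h2, Functor.map_zero]
    · rintro f ⟨hf, hf'⟩
      obtain ⟨g, rfl⟩ := (τ.mem_killed_iff hT).1 hf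
      obtain ⟨g, rfl⟩ := (shiftFunctor C (1 : ℤ)).map_surjective g
      have h1 : kernel.ι q ≫ (homFunctor T).map g = 0 := by
        apply ModuleCat.hom_ext
        apply LinearMap.ext
        intro z
        obtain ⟨t, ht⟩ : ∃ t : T ⟶ τ.T₁, t = (kernel.ι q).hom z := ⟨_, rfl⟩
        have h2 : q.hom t = 0 := by
          rw [ht]
          exact congrArg (fun φ => φ.hom z) (kernel.condition q)
        have h3 : t⟦(1 : ℤ)⟧' ≫ τ.a⟦(1 : ℤ)⟧' = 0 := by
          rw [← Functor.map_comp, (hqi t).1 h2, Functor.map_zero]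
        obtain ⟨s, hs⟩ := dist_lift₁ τ.dist _ h3
        have h4 : t ≫ g = 0 := by
          apply (shiftFunctor C (1 : ℤ)).map_injective
          rw [Functor.map_comp, hs, Category.assoc, hf' s, Functor.map_zero]
        change (show T ⟶ τ.T₁ from (kernel.ι q).hom z) ≫ g = 0
        rw [← ht]
        exact h4
      refine ⟨Abelian.epiDesc q _ h1, ?_⟩
      rw [hψ', Abelian.comp_epiDesc]
      congr 2
      exact ε.symm_apply_apply g
  rw [hrange]

end Dimensions

/-! ### Serre duality -/

section Duality

variable (k : Type w) [Field k] {C : Type u} [Category.{v} C] [Preadditive C] [Linear k C]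
  [HasZeroObject C] [HasShift C ℤ] [∀ n : ℤ, (shiftFunctor C n).Additive]

section

variable [∀ n : ℤ, (shiftFunctor C n).Linear k]

omit [HasZeroObject C] in
variable {k} in
/-- The duality `D C(X, Σ Y) ≃ C(Y, Σ X)` of a 2-Calabi-Yau category, and the part of its
naturality that is needed. -/
theorem IsTwoCalabiYau.exists_equiv (hCY : IsTwoCalabiYau k C) (X Y : C) :
    ∃ θ : Module.Dual k (X ⟶ Y⟦(1 : ℤ)⟧) ≃ₗ[k] (Y ⟶ X⟦(1 : ℤ)⟧),
      ∀ (φ : Module.Dual k (X ⟶ Y⟦(1 : ℤ)⟧)) (W : C) (t : W ⟶ Y),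
        t ≫ θ φ = 0 ↔ ∀ u : X ⟶ W⟦(1 : ℤ)⟧, φ (u ≫ t⟦(1 : ℤ)⟧') = 0 := by
  obtain ⟨e, -, he⟩ := hCY
  let ι : X⟦(2 : ℤ)⟧ ≅ X⟦(1 : ℤ)⟧⟦(1 : ℤ)⟧ :=
    (shiftFunctorAdd' C (1 : ℤ) 1 2 (by norm_num)).app X
  let σ : (Y ⟶ X⟦(1 : ℤ)⟧) ≃ₗ[k] (Y⟦(1 : ℤ)⟧ ⟶ X⟦(2 : ℤ)⟧) :=
    (LinearEquiv.ofBijective ((shiftFunctor C (1 : ℤ)).mapLinearMap k)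
      ⟨(shiftFunctor C (1 : ℤ)).map_injective, (shiftFunctor C (1 : ℤ)).map_surjective⟩).trans
      (Linear.homCongr k (Iso.refl _) ι.symm)
  have hσ : ∀ f, σ f = f⟦(1 : ℤ)⟧' ≫ ι.inv := fun f => by
    change (𝟙 _ ≫ f⟦(1 : ℤ)⟧') ≫ ι.inv = _
    rw [Category.id_comp]
  refine ⟨(e X (Y⟦(1 : ℤ)⟧)).trans σ.symm, fun φ W t => ?_⟩
  have h1 : t ≫ σ.symm (e X (Y⟦(1 : ℤ)⟧) φ) = 0 ↔ t⟦(1 : ℤ)⟧' ≫ e X (Y⟦(1 : ℤ)⟧) φ = 0 := by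
    obtain ⟨g, hg⟩ := σ.surjective (e X (Y⟦(1 : ℤ)⟧) φ)
    rw [← hg, LinearEquiv.symm_apply_apply, hσ, ← Category.assoc, ← Functor.map_comp]
    constructor
    · intro h
      rw [h, Functor.map_zero, zero_comp]
    · intro h
      rw [Preadditive.IsIso.comp_right_eq_zero] at h
      exact (shiftFunctor C (1 : ℤ)).map_injective (by rw [h, Functor.map_zero])
  rw [LinearEquiv.trans_apply, h1, ← he, LinearEquiv.map_eq_zero_iff]
  constructor
  · intro h u
    exact LinearMap.congr_fun h u
  · intro h
    ext u
    exact h u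

end

variable [Pretriangulated C] {T : C} (hT : IsClusterTilting T)

section

variable {k}

include hT

/-- The orthogonal of the space of morphisms `X ⟶ Σ Y` killed by `T` is the space of morphisms
`Y ⟶ Σ X` killed by `T`. -/
theorem IndexTriangle.mem_killed_serre {X Y : C} (τ : IndexTriangle T X)
    {θ : Module.Dual k (X ⟶ Y⟦(1 : ℤ)⟧) ≃ₗ[k] (Y ⟶ X⟦(1 : ℤ)⟧)}
    (hθ : ∀ (φ : Module.Dual k (X ⟶ Y⟦(1 : ℤ)⟧)) (W : C) (t : W ⟶ Y),
        t ≫ θ φ = 0 ↔ ∀ u : X ⟶ W⟦(1 : ℤ)⟧, φ (u ≫ t⟦(1 : ℤ)⟧') = 0)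
    (φ : Module.Dual k (X ⟶ Y⟦(1 : ℤ)⟧)) :
    θ φ ∈ killed k T Y (X⟦(1 : ℤ)⟧) ↔
      φ ∈ (killed k T X (Y⟦(1 : ℤ)⟧)).dualAnnihilator := by
  rw [Submodule.mem_dualAnnihilator]
  constructor
  · intro h f hf
    obtain ⟨g, rfl⟩ := (τ.mem_killed_iff hT).1 hf
    obtain ⟨g, rfl⟩ := (shiftFunctor C (1 : ℤ)).map_surjective g
    exact (hθ φ _ g).1 (comp_eq_zero_of_addClosure τ.h₁ h g) _
  · intro h t
    rw [hθ]
    intro u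
    refine h _ fun s => ?_
    rw [← Category.assoc, hT.rigid (s ≫ u), zero_comp]

/-- The orthogonal of the space of morphisms `Σ Z ⟶ Σ Y` killed by `Σ T` is the space of
morphisms `Y ⟶ Σ² Z` killed by `Σ T`. -/
theorem IndexTriangle.mem_killed_shift_serre {Z Y : C} (τ : IndexTriangle T Z)
    {θ : Module.Dual k (Z⟦(1 : ℤ)⟧ ⟶ Y⟦(1 : ℤ)⟧) ≃ₗ[k] (Y ⟶ Z⟦(1 : ℤ)⟧⟦(1 : ℤ)⟧)}
    (hθ : ∀ (φ : Module.Dual k (Z⟦(1 : ℤ)⟧ ⟶ Y⟦(1 : ℤ)⟧)) (W : C) (t : W ⟶ Y),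
        t ≫ θ φ = 0 ↔ ∀ u : Z⟦(1 : ℤ)⟧ ⟶ W⟦(1 : ℤ)⟧, φ (u ≫ t⟦(1 : ℤ)⟧') = 0)
    (φ : Module.Dual k (Z⟦(1 : ℤ)⟧ ⟶ Y⟦(1 : ℤ)⟧)) :
    θ φ ∈ killed k (T⟦(1 : ℤ)⟧) Y (Z⟦(1 : ℤ)⟧⟦(1 : ℤ)⟧) ↔
      φ ∈ (killed k (T⟦(1 : ℤ)⟧) (Z⟦(1 : ℤ)⟧) (Y⟦(1 : ℤ)⟧)).dualAnnihilator := by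
  rw [Submodule.mem_dualAnnihilator]
  constructor
  · intro h f hf
    obtain ⟨f, rfl⟩ := (shiftFunctor C (1 : ℤ)).map_surjective f
    have hf' : f ∈ killed k T Z Y := fun t => by
      apply (shiftFunctor C (1 : ℤ)).map_injective
      rw [Functor.map_comp, hf, Functor.map_zero]
    obtain ⟨g, rfl⟩ := (τ.mem_killed_iff hT).1 hf'
    rw [Functor.map_comp]
    exact (hθ φ _ g).1 (comp_eq_zero_of_addClosure_map τ.h₁ _ h g) _
  · intro h t
    rw [hθ]
    intro u
    refine h _ fun s => ?_
    obtain ⟨g, hg⟩ : ∃ g : T ⟶ T⟦(1 : ℤ)⟧, g⟦(1 : ℤ)⟧' = s ≫ u :=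
      (shiftFunctor C (1 : ℤ)).map_surjective (s ≫ u)
    rw [← Category.assoc, ← hg, hT.rigid g, Functor.map_zero, zero_comp]

end

variable [∀ n : ℤ, (shiftFunctor C n).Linear k] [HomFinite k C] (hCY : IsTwoCalabiYau k C)

include hT

include hCY in
omit hT [HomFinite k C] [Pretriangulated C] [HasZeroObject C] in
theorem finrank_hom_shift_comm (X Y : C) :
    Module.finrank k (X ⟶ Y⟦(1 : ℤ)⟧) = Module.finrank k (Y ⟶ X⟦(1 : ℤ)⟧) := by
  obtain ⟨θ, -⟩ := hCY.exists_equiv X Y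
  rw [← θ.finrank_eq, Subspace.dual_finrank_eq]

include hCY in
theorem finrank_killed_add (X Y : C) :
    Module.finrank k (killed k T X (Y⟦(1 : ℤ)⟧)) + Module.finrank k (killed k T Y (X⟦(1 : ℤ)⟧)) =
      Module.finrank k (X ⟶ Y⟦(1 : ℤ)⟧) := by
  obtain ⟨τ⟩ := exists_indexTriangle k hT X
  obtain ⟨θ, hθ⟩ := hCY.exists_equiv X Y
  have h : killed k T Y (X⟦(1 : ℤ)⟧) =
      (killed k T X (Y⟦(1 : ℤ)⟧)).dualAnnihilator.map θ.toLinearMap := by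
    ext f
    obtain ⟨φ, rfl⟩ := θ.surjective f
    rw [τ.mem_killed_serre hT hθ]
    simp
  rw [h, LinearEquiv.finrank_map_eq]
  exact Subspace.finrank_add_finrank_dualAnnihilator_eq _

include hCY in
/-- The antisymmetrized Euler form `⟨F Σ Z, F Y⟩ₐ` is the sum of the values at `Σ Z` and `Z` of
the index pairing with `F Y`. -/
theorem eulerAnti_homFunctor_shift (Z Y : C) :
    eulerAnti k ((homFunctor T).obj (Z⟦(1 : ℤ)⟧)) ((homFunctor T).obj Y) =
      ((Module.finrank k ((homFunctor T).obj (Z⟦(1 : ℤ)⟧) ⟶ (homFunctor T).obj Y) : ℤ) -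
        Module.finrank k (killed k T (Z⟦(1 : ℤ)⟧) (Y⟦(1 : ℤ)⟧))) +
      ((Module.finrank k ((homFunctor T).obj Z ⟶ (homFunctor T).obj Y) : ℤ) -
        Module.finrank k (killed k T Z (Y⟦(1 : ℤ)⟧))) := by
  obtain ⟨τ⟩ := exists_indexTriangle k hT (Z⟦(1 : ℤ)⟧)
  obtain ⟨τ'⟩ := exists_indexTriangle k hT Z
  obtain ⟨θ, hθ⟩ := hCY.exists_equiv (Z⟦(1 : ℤ)⟧) Y
  let S : (Z ⟶ Y) ≃ₗ[k] (Z⟦(1 : ℤ)⟧ ⟶ Y⟦(1 : ℤ)⟧) :=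
    LinearEquiv.ofBijective ((shiftFunctor C (1 : ℤ)).mapLinearMap k)
      ⟨(shiftFunctor C (1 : ℤ)).map_injective, (shiftFunctor C (1 : ℤ)).map_surjective⟩
  let U := killed k T (Z⟦(1 : ℤ)⟧) (Y⟦(1 : ℤ)⟧)
  let V := killed k (T⟦(1 : ℤ)⟧) (Z⟦(1 : ℤ)⟧) (Y⟦(1 : ℤ)⟧)
  have hV : V = (killed k T Z Y).map S.toLinearMap := by
    ext f
    obtain ⟨f, rfl⟩ := S.surjective f
    have h1 : S f ∈ V ↔ f ∈ killed k T Z Y := by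
      change (∀ t, t ≫ f⟦(1 : ℤ)⟧' = 0) ↔ ∀ t, t ≫ f = 0
      constructor
      · intro h t
        apply (shiftFunctor C (1 : ℤ)).map_injective
        rw [Functor.map_comp, h, Functor.map_zero]
      · intro h t
        obtain ⟨t, rfl⟩ := (shiftFunctor C (1 : ℤ)).map_surjective t
        rw [← Functor.map_comp, h, Functor.map_zero]
    rw [h1]
    simp
  have hUV : killed k T Y (Z⟦(1 : ℤ)⟧⟦(1 : ℤ)⟧) ⊓ killed k (T⟦(1 : ℤ)⟧) Y (Z⟦(1 : ℤ)⟧⟦(1 : ℤ)⟧) =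
      (U ⊔ V).dualAnnihilator.map θ.toLinearMap := by
    ext f
    obtain ⟨φ, rfl⟩ := θ.surjective f
    rw [Submodule.mem_inf, τ.mem_killed_serre hT hθ, τ'.mem_killed_shift_serre hT hθ,
      Submodule.dualAnnihilator_sup_eq]
    simp [U, V]
  have e1 : Module.finrank k V = Module.finrank k (killed k T Z Y) := by
    rw [hV, LinearEquiv.finrank_map_eq]
  have e2 := finrank_ext_homFunctor k hT (Z⟦(1 : ℤ)⟧) Y
  have e3 := finrank_ext_homFunctor k hT Y (Z⟦(1 : ℤ)⟧)
  rw [hUV, LinearEquiv.finrank_map_eq] at e3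
  have e4 := Subspace.finrank_add_finrank_dualAnnihilator_eq (U ⊔ V)
  have e5 := Submodule.finrank_sup_add_finrank_inf_eq U V
  have e6 := S.finrank_eq
  have e7 := finrank_hom_homFunctor k hT Z Y
  have e8 := finrank_hom_homFunctor k hT Y (Z⟦(1 : ℤ)⟧)
  have e9 := finrank_killed_add k hT hCY Z Y
  have e10 := finrank_hom_shift_comm k hCY Z Y
  change _ = Module.finrank k ((U ⊓ V : Submodule k _)) at e2
  rw [eulerAnti, euler, euler, e2]
  change _ = ((_ : ℤ) - Module.finrank k U) + _
  omega

end Duality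

/-! ### The antisymmetrized Euler form on the Grothendieck group -/

theorem K0Mod.hom_ext {k : Type w} [Field k] {A : Type v} [Ring A] [Algebra k A] {G : Type*}
    [AddCommGroup G] {f g : K0Mod k A →+ G}
    (h : ∀ N : FDMod k A, f (K0Mod.cls N) = g (K0Mod.cls N)) : f = g := by
  apply QuotientAddGroup.addMonoidHom_ext
  apply FreeAbelianGroup.lift_ext
  exact h

theorem K0Mod.cls_eq_add {k : Type w} [Field k] {A : Type v} [Ring A] [Algebra k A]
    {M₁ M₂ M₃ : FDMod k A} {f : M₁.obj ⟶ M₂.obj} {g : M₂.obj ⟶ M₃.obj} {h : f ≫ g = 0}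
    (hS : (ShortComplex.mk f g h).ShortExact) :
    (K0Mod.cls M₂ : K0Mod k A) = K0Mod.cls M₁ + K0Mod.cls M₃ := by
  rw [← sub_eq_zero, ← sub_sub]
  exact (QuotientAddGroup.eq_zero_iff _).2
    (AddSubgroup.subset_closure ⟨M₁, M₂, M₃, f, g, h, hS, rfl⟩)

theorem finDim_of_mono {k : Type w} [Field k] {A : Type v} [Ring A] [Algebra k A]
    {M N : ModuleCat.{v} A} (f : M ⟶ N) [Mono f] (hN : finDim k A N) : finDim k A M :=
  have : Module.Finite k N := hN
  Module.Finite.of_injective (f.hom.restrictScalars k)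
    ((ModuleCat.mono_iff_injective f).1 inferInstance)

theorem finDim_of_epi {k : Type w} [Field k] {A : Type v} [Ring A] [Algebra k A]
    {M N : ModuleCat.{v} A} (f : M ⟶ N) [Epi f] (hM : finDim k A M) : finDim k A N :=
  have : Module.Finite k M := hM
  Module.Finite.of_surjective (f.hom.restrictScalars k)
    ((ModuleCat.epi_iff_surjective f).1 inferInstance)

section Form

variable (k : Type w) [Field k] {C : Type u} [Category.{v} C] [Preadditive C] [Linear k C]
  [HasZeroObject C] [HasShift C ℤ] [∀ n : ℤ, (shiftFunctor C n).Additive]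
  [Pretriangulated C] [HomFinite k C] {T : C} (hT : IsClusterTilting T)

/-- The homomorphism `m ↦ f_{T,m}(X)`. -/
noncomputable def friezeHom (X : C) : K0Mod k (End T)ᵐᵒᵖ →+ ℤ := pairing k T (index k hT X)

theorem friezeFun_eq (m : K0Mod k (End T)ᵐᵒᵖ) (X : C) :
    friezeFun k hT m X = friezeHom k hT X m := rfl

theorem pairing_cls (W : (addClosure T).FullSubcategory) (N : FDMod k (End T)ᵐᵒᵖ) :
    pairing k T (K0Split.cls W) (K0Mod.cls N) = euler k ((homFunctor T).obj W.obj) N.obj := by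
  have h : pairing k T (K0Split.cls W) = pairingObj k T W := FreeAbelianGroup.lift_apply_of _ _
  rw [h]
  exact FreeAbelianGroup.lift_apply_of _ _

theorem friezeHom_cls [∀ n : ℤ, (shiftFunctor C n).Linear k] (X : C) {N : FDMod k (End T)ᵐᵒᵖ}
    {Y : C} (e : N.obj ≅ (homFunctor T).obj Y) :
    friezeHom k hT X (K0Mod.cls N) =
      Module.finrank k ((homFunctor T).obj X ⟶ (homFunctor T).obj Y) -
        Module.finrank k (killed k T X (Y⟦(1 : ℤ)⟧)) := by
  have h := exists_index_triangle k hT X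
  obtain ⟨a, b, c, hd⟩ := h.choose_spec.choose_spec
  let τ : IndexTriangle T X := ⟨_, _, a, b, c, h.choose.property, h.choose_spec.choose.property, hd⟩
  have hp : ∀ W : (addClosure T).FullSubcategory,
      pairing k T (K0Split.cls W) (K0Mod.cls N) = Module.finrank k (W.obj ⟶ Y) := by
    intro W
    have := homFunctor_projective W.property
    rw [pairing_cls, euler_congr k (Iso.refl _) e, euler_of_projective,
      (homFunctorEquiv k W.property Y).finrank_eq]
  rw [← τ.finrank_sub_finrank k hT Y, friezeHom, index, map_sub, AddMonoidHom.sub_apply, hp, hp]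

include k hT

omit hT [HomFinite k C] in
/-- Every finite-dimensional module is a quotient of `F W` for some `W` in `add T`. -/
theorem exists_epi_homFunctor (N : ModuleCat.{v} (End T)ᵐᵒᵖ) (hN : Module.Finite k N) :
    ∃ (W : C) (φ : (homFunctor T).obj W ⟶ N), addClosure T W ∧ Epi φ := by
  let v := Module.finBasis k N
  let G := fun _ : Fin (Module.finrank k N) => T
  have h : ∀ x : N, ∃ ψ : (homFunctor T).obj T ⟶ N, ψ.hom (𝟙 T : T ⟶ T) = x := by
    intro x
    refine ⟨ModuleCat.ofHom
      { toFun := fun g => (MulOpposite.op (show End T from g)) • x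
        map_add' := fun a b => by
          rw [← add_smul]; rfl
        map_smul' := fun a b => by
          rw [RingHom.id_apply, ← mul_smul]; rfl }, ?_⟩
    exact one_smul (End T)ᵐᵒᵖ x
  choose ψ hψ using fun i => h (v i)
  let φ : (homFunctor T).obj (⨁ G) ⟶ N :=
    ((homFunctor T).mapBiproduct G).hom ≫ biproduct.desc ψ
  have hφ : ∀ i, (homFunctor T).map (biproduct.ι G i) ≫ φ = ψ i := by
    intro i
    have h1 : (homFunctor T).map (biproduct.ι G i) =
        biproduct.ι ((homFunctor T).obj ∘ G) i ≫ ((homFunctor T).mapBiproduct G).inv := by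
      rw [Functor.mapBiproduct_inv, biproduct.ι_desc]
    rw [h1, Category.assoc, Iso.inv_hom_id_assoc, biproduct.ι_desc]
  refine ⟨⨁ G, φ, ⟨_, ⟨Retract.refl _⟩⟩, ?_⟩
  rw [ModuleCat.epi_iff_surjective]
  have hrange : LinearMap.range (φ.hom.restrictScalars k) = ⊤ := by
    rw [eq_top_iff, ← v.span_eq, Submodule.span_le]
    rintro _ ⟨i, rfl⟩
    refine ⟨((homFunctor T).map (biproduct.ι G i)).hom (𝟙 T : T ⟶ T), ?_⟩
    exact (congrArg (fun χ => χ.hom (𝟙 T : T ⟶ T)) (hφ i)).trans (hψ i)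
  intro x
  exact LinearMap.range_eq_top.1 hrange x

/-- Every finite-dimensional module is `F X` for some `X`: a presentation `F W₁ ⟶ F W₀` with `W₁`
and `W₀` in `add T` comes from a morphism `W₁ ⟶ W₀`, whose cone is mapped by `F` to the module. -/
theorem exists_homFunctor_iso (N : FDMod k (End T)ᵐᵒᵖ) :
    ∃ X : C, Nonempty (N.obj ≅ (homFunctor T).obj X) := by
  obtain ⟨W₀, φ, hW₀, hφ⟩ := exists_epi_homFunctor k N.obj N.property
  have hK : Module.Finite k (kernel φ : ModuleCat.{v} (End T)ᵐᵒᵖ) :=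
    finDim_of_mono (kernel.ι φ) (homFunctor_finite k T W₀)
  obtain ⟨W₁, ψ, hW₁, hψ⟩ := exists_epi_homFunctor k (kernel φ) hK
  obtain ⟨a, ha⟩ : ∃ a : W₁ ⟶ W₀, (homFunctor T).map a = ψ ≫ kernel.ι φ :=
    (homFunctor_map_bijective_of_addClosure hW₁ W₀).2 _
  obtain ⟨X, b, c, hd⟩ := distinguished_cocone_triangle a
  let τ : IndexTriangle T X := ⟨_, _, a, b, c, hW₁, hW₀, hd⟩
  have h1 : (homFunctor T).map a ≫ φ = 0 := by
    rw [ha, Category.assoc, kernel.condition, comp_zero]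
  have h2 : (homFunctor T).map a ≫ (homFunctor T).map b = 0 := by
    rw [← Functor.map_comp, dist_comp₁₂ hd, Functor.map_zero]
  have ex1 : (ShortComplex.mk _ _ h1).Exact := by
    rw [ShortComplex.exact_iff_epi_kernel_lift]
    have h3 : kernel.lift φ _ h1 = ψ := by
      rw [← cancel_mono (kernel.ι φ), kernel.lift_ι, ha]
    exact h3 ▸ hψ
  have ex2 : (ShortComplex.mk _ _ h2).Exact := by
    rw [ShortComplex.moduleCat_exact_iff]
    intro x hx
    obtain ⟨y, hy⟩ := dist_lift₂ hd (show T ⟶ W₀ from x) hx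
    exact ⟨y, hy.symm⟩
  have : Epi ((homFunctor T).map b) := τ.epi_map_b hT
  exact ⟨X, ⟨IsColimit.coconePointUniqueUpToIso ex1.gIsCokernel ex2.gIsCokernel⟩⟩

theorem exists_homFunctor_shift_iso (N : FDMod k (End T)ᵐᵒᵖ) :
    ∃ Z : C, Nonempty (N.obj ≅ (homFunctor T).obj (Z⟦(1 : ℤ)⟧)) := by
  obtain ⟨X, ⟨e⟩⟩ := exists_homFunctor_iso k hT N
  exact ⟨X⟦(-1 : ℤ)⟧, ⟨e ≪≫ (homFunctor T).mapIso ((shiftEquiv C (1 : ℤ)).counitIso.app X).symm⟩⟩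

variable [∀ n : ℤ, (shiftFunctor C n).Linear k] (hCY : IsTwoCalabiYau k C)

include hCY

theorem eulerAnti_eq_friezeHom {M N : FDMod k (End T)ᵐᵒᵖ} {Z : C}
    (e : M.obj ≅ (homFunctor T).obj (Z⟦(1 : ℤ)⟧)) :
    eulerAnti k M.obj N.obj =
      (friezeHom k hT (Z⟦(1 : ℤ)⟧) + friezeHom k hT Z) (K0Mod.cls N) := by
  obtain ⟨Y, ⟨e'⟩⟩ := exists_homFunctor_iso k hT N
  rw [AddMonoidHom.add_apply, friezeHom_cls k hT _ e', friezeHom_cls k hT _ e',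
    ← eulerAnti_homFunctor_shift k hT hCY, eulerAnti, eulerAnti, euler_congr k e e',
    euler_congr k e' e]

/-- The antisymmetrized Euler form descends to the Grothendieck group. In the second argument this
holds because `⟨F Σ Z, ?⟩ₐ` is a sum of two index pairings, and in the first argument by
antisymmetry. -/
theorem exists_eulerAntiForm :
    ∃ β : K0Mod k (End T)ᵐᵒᵖ →+ K0Mod k (End T)ᵐᵒᵖ →+ ℤ,
      ∀ M N : FDMod k (End T)ᵐᵒᵖ, β (K0Mod.cls M) (K0Mod.cls N) = eulerAnti k M.obj N.obj := by
  choose Z e using exists_homFunctor_shift_iso k hT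
  let γ : FDMod k (End T)ᵐᵒᵖ → K0Mod k (End T)ᵐᵒᵖ →+ ℤ := fun M =>
    friezeHom k hT ((Z M)⟦(1 : ℤ)⟧) + friezeHom k hT (Z M)
  have hγ : ∀ M N, γ M (K0Mod.cls N) = eulerAnti k M.obj N.obj := fun M N =>
    (eulerAnti_eq_friezeHom k hT hCY (e M).some).symm
  have hγ' : ∀ M N, γ M (K0Mod.cls N) = -γ N (K0Mod.cls M) := fun M N => by
    rw [hγ, hγ, eulerAnti, eulerAnti, neg_sub]
  refine ⟨QuotientAddGroup.lift _ (FreeAbelianGroup.lift γ) ?_, fun M N => ?_⟩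
  · rw [AddSubgroup.closure_le]
    rintro _ ⟨M₁, M₂, M₃, f, g, h, hS, rfl⟩
    rw [SetLike.mem_coe, AddMonoidHom.mem_ker, map_sub, map_sub, FreeAbelianGroup.lift_apply_of,
      FreeAbelianGroup.lift_apply_of, FreeAbelianGroup.lift_apply_of]
    apply K0Mod.hom_ext
    intro N
    have h0 := congrArg (γ N) (K0Mod.cls_eq_add hS)
    rw [map_add] at h0
    rw [AddMonoidHom.sub_apply, AddMonoidHom.sub_apply, hγ' M₂, hγ' M₁, hγ' M₃]
    change _ = (0 : ℤ)
    omega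
  · rw [← hγ]
    exact congrArg (fun χ : K0Mod k (End T)ᵐᵒᵖ →+ ℤ => χ (K0Mod.cls N))
      (FreeAbelianGroup.lift_apply_of γ M)

end Form

/-! ### The index pairing on triangles -/

section Additivity

variable (k : Type w) [Field k] {C : Type u} [Category.{v} C] [Preadditive C] [Linear k C]
  [HasZeroObject C] [HasShift C ℤ] [∀ n : ℤ, (shiftFunctor C n).Additive]
  [∀ n : ℤ, (shiftFunctor C n).Linear k]
  [Pretriangulated C] [HomFinite k C] {T : C} (hT : IsClusterTilting T)

/-- The index pairing is additive on the triangles `L → E → M → Σ L` whose third morphism `ε` is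
killed by `T`. With `N(X, Y)` the space of morphisms killed by `T`, this is the exactness of
`0 → Hom(F M, F Y) → Hom(F E, F Y) → Hom(F L, F Y) → N(M, Σ Y) → N(E, Σ Y) → N(L, Σ Y) → 0`. -/
theorem friezeHom_add_of_killed {L E M : C} {i : L ⟶ E} {p : E ⟶ M} {ε : M ⟶ L⟦(1 : ℤ)⟧}
    (H : Triangle.mk i p ε ∈ distTriang C) (hε : ∀ t : T ⟶ M, t ≫ ε = 0) :
    friezeHom k hT E = friezeHom k hT L + friezeHom k hT M := by
  apply K0Mod.hom_ext
  intro N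
  obtain ⟨Y, ⟨e⟩⟩ := exists_homFunctor_iso k hT N
  rw [AddMonoidHom.add_apply, friezeHom_cls k hT E e, friezeHom_cls k hT L e,
    friezeHom_cls k hT M e]
  obtain ⟨τL⟩ := exists_indexTriangle k hT L
  obtain ⟨τM⟩ := exists_indexTriangle k hT M
  have hp : ∀ t : T ⟶ M, ∃ s : T ⟶ E, t = s ≫ p := fun t => dist_lift₃ H t (hε t)
  have hepi : Epi ((homFunctor T).map p) := by
    rw [ModuleCat.epi_iff_surjective]
    intro t
    obtain ⟨s, hs⟩ := hp t
    exact ⟨s, hs.symm⟩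
  have hip : (homFunctor T).map i ≫ (homFunctor T).map p = 0 := by
    rw [← Functor.map_comp, dist_comp₁₂ H, Functor.map_zero]
  have hex : (ShortComplex.mk _ _ hip).Exact := by
    rw [ShortComplex.moduleCat_exact_iff]
    intro x hx
    obtain ⟨y, hy⟩ := dist_lift₂ H (show T ⟶ E from x) hx
    exact ⟨y, hy.symm⟩
  let d₁ := Linear.leftComp k ((homFunctor T).obj Y) ((homFunctor T).map p)
  let d₂ := Linear.leftComp k ((homFunctor T).obj Y) ((homFunctor T).map i)
  let ρ := Linear.leftComp k Y i
  let ψ : (L ⟶ Y) →ₗ[k] killed k T M (Y⟦(1 : ℤ)⟧) :=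
    (compShift ε Y).codRestrict _ fun a t => by
      change t ≫ ε ≫ a⟦(1 : ℤ)⟧' = 0
      rw [← Category.assoc, hε, zero_comp]
  let π₁ : killed k T M (Y⟦(1 : ℤ)⟧) →ₗ[k] killed k T E (Y⟦(1 : ℤ)⟧) :=
    (Linear.leftComp k _ p).restrict fun f hf t => by
      change t ≫ p ≫ f = 0
      rw [← Category.assoc, hf]
  let π₂ : killed k T E (Y⟦(1 : ℤ)⟧) →ₗ[k] killed k T L (Y⟦(1 : ℤ)⟧) :=
    (Linear.leftComp k _ i).restrict fun f hf t => by
      change t ≫ i ≫ f = 0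
      rw [← Category.assoc, hf]
  have hd₁ : Function.Injective d₁ := fun x y h => (cancel_epi ((homFunctor T).map p)).1 h
  have hd₂ : LinearMap.ker d₂ = LinearMap.range d₁ := by
    ext x
    constructor
    · intro hx
      exact ⟨hex.desc x hx, hex.g_desc x hx⟩
    · rintro ⟨y, rfl⟩
      change (homFunctor T).map i ≫ (homFunctor T).map p ≫ y = 0
      rw [← Category.assoc, hip, zero_comp]
  have hrange : LinearMap.range d₂ = (LinearMap.range ρ).map (homFunctorMap k T L Y) := by
    ext x
    constructor
    · rintro ⟨y, rfl⟩
      obtain ⟨f, rfl⟩ := homFunctor_map_surjective k hT y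
      exact ⟨i ≫ f, ⟨f, rfl⟩, (homFunctor T).map_comp i f⟩
    · rintro ⟨_, ⟨f, rfl⟩, rfl⟩
      exact ⟨(homFunctor T).map f, ((homFunctor T).map_comp i f).symm⟩
  have hψ : LinearMap.ker ψ = LinearMap.range ρ := by
    ext a
    rw [LinearMap.mem_ker, ← Subtype.coe_inj]
    change ε ≫ a⟦(1 : ℤ)⟧' = 0 ↔ ∃ b : E ⟶ Y, i ≫ b = a
    constructor
    · intro h
      obtain ⟨b, hb⟩ := dist_desc₁ H a h
      exact ⟨b, hb.symm⟩
    · rintro ⟨b, rfl⟩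
      rw [Functor.map_comp, ← Category.assoc, dist_comp₃₁ H, zero_comp]
  -- `ε` factors through `Σ T₁ᴹ` and `a` through `Σ T₁ᴸ`, so `Σ a ∘ ε` vanishes by rigidity.
  have hle : killed k T L Y ≤ LinearMap.range ρ := by
    intro a ha
    rw [← hψ, LinearMap.mem_ker, ← Subtype.coe_inj]
    change ε ≫ a⟦(1 : ℤ)⟧' = 0
    obtain ⟨g, rfl⟩ := (τM.mem_killed_iff (k := k) hT).1 hε
    obtain ⟨g, rfl⟩ := (shiftFunctor C (1 : ℤ)).map_surjective g
    rw [Category.assoc, ← Functor.map_comp, comp_eq_zero_of_addClosure τM.h₁ ha, Functor.map_zero,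
      comp_zero]
  have hπ₁ : LinearMap.ker π₁ = LinearMap.range ψ := by
    ext u
    rw [LinearMap.mem_ker, ← Subtype.coe_inj]
    change p ≫ u.1 = 0 ↔ _
    constructor
    · intro h
      obtain ⟨g, hg⟩ := dist_desc₃ H u.1 h
      obtain ⟨g, rfl⟩ := (shiftFunctor C (1 : ℤ)).map_surjective g
      exact ⟨g, Subtype.ext hg.symm⟩
    · rintro ⟨a, rfl⟩
      change p ≫ ε ≫ a⟦(1 : ℤ)⟧' = 0
      rw [← Category.assoc, dist_comp₂₃ H, zero_comp]
  have hπ₂ : LinearMap.ker π₂ = LinearMap.range π₁ := by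
    ext u
    rw [LinearMap.mem_ker, ← Subtype.coe_inj]
    change i ≫ u.1 = 0 ↔ _
    constructor
    · intro h
      obtain ⟨x, hx⟩ := dist_desc₂ H u.1 h
      refine ⟨⟨x, fun t => ?_⟩, Subtype.ext hx.symm⟩
      obtain ⟨s, rfl⟩ := hp t
      rw [Category.assoc, ← hx, u.2]
    · rintro ⟨x, rfl⟩
      change i ≫ p ≫ x.1 = 0
      rw [← Category.assoc, dist_comp₁₂ H, zero_comp]
  -- a morphism `L ⟶ Σ T₁ᴸ` extends along `i` because `Σ⁻¹ ε` factors through `add T`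
  have hπ₂' : Function.Surjective π₂ := by
    rintro ⟨u, hu⟩
    obtain ⟨g, rfl⟩ := (τL.mem_killed_iff hT).1 hu
    have h0 : ε ≫ τL.c⟦(1 : ℤ)⟧' = 0 := by
      obtain ⟨g, rfl⟩ := (τM.mem_killed_iff (k := k) hT).1 hε
      obtain ⟨g, rfl⟩ := (shiftFunctor C (1 : ℤ)).map_surjective g
      rw [Category.assoc, ← Functor.map_comp,
        comp_eq_zero_of_addClosure τM.h₁ (τL.comp_c hT), Functor.map_zero, comp_zero]
    obtain ⟨x, hx⟩ := dist_desc₁ H _ h0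
    refine ⟨⟨x ≫ g, fun t => ?_⟩, Subtype.ext ?_⟩
    · rw [← Category.assoc, hT.rigid_add τL.h₁ (t ≫ x), zero_comp]
    · change i ≫ x ≫ g = _
      rw [← Category.assoc, ← hx]
  have := finite_hom k (homFunctor_finite k T E) (homFunctor_finite k T Y)
  have f1 := LinearMap.finrank_range_of_inj hd₁
  have f2 := LinearMap.finrank_range_add_finrank_ker d₂
  have f3 := LinearMap.finrank_range_add_finrank_ker
    ((homFunctorMap k T L Y).domRestrict (LinearMap.range ρ))
  have f4 := LinearMap.finrank_range_add_finrank_ker ψ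
  have f5 := LinearMap.finrank_range_add_finrank_ker π₁
  have f6 := LinearMap.finrank_range_add_finrank_ker π₂
  have f7 := finrank_hom_homFunctor k hT L Y
  rw [hd₂] at f2
  rw [LinearMap.range_domRestrict, ← hrange, LinearMap.ker_domRestrict, ker_homFunctorMap] at f3
  have f8 := (Submodule.submoduleOfEquivOfLe hle).finrank_eq
  rw [Submodule.submoduleOf] at f8
  rw [f8] at f3
  rw [hψ] at f4
  rw [hπ₁] at f5
  rw [hπ₂, LinearMap.range_eq_top.2 hπ₂', finrank_top] at f6
  omega

theorem friezeHom_congr {X Y : C} (e : X ≅ Y) : friezeHom k hT X = friezeHom k hT Y := by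
  obtain ⟨Z, hZ⟩ := HasZeroObject.zero (C := C)
  have h : ∀ {X Y : C} (e : X ≅ Y), friezeHom k hT Y = friezeHom k hT X + friezeHom k hT Z :=
    fun {X Y} e => friezeHom_add_of_killed k hT (i := e.hom) (p := (0 : Y ⟶ Z))
      (ε := (0 : Z ⟶ X⟦(1 : ℤ)⟧))
      ((Triangle.distinguished_iff_of_isZero₃ _ hZ).2 (inferInstanceAs (IsIso e.hom)))
      fun t => comp_zero
  have h0 : friezeHom k hT Z = 0 := by simpa using h (Iso.refl Z)
  rw [h e, h0, add_zero]

theorem friezeHom_biprod (X Y : C) :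
    friezeHom k hT (X ⊞ Y) = friezeHom k hT X + friezeHom k hT Y :=
  friezeHom_add_of_killed k hT (binaryBiproductTriangle_distinguished X Y) fun _ => comp_zero

omit [Linear k C] [∀ n : ℤ, (shiftFunctor C n).Linear k] [HomFinite k C] in
/-- A triangle is distinguished if its shift, with the sign carried by the third morphism, is. -/
theorem unshift_distinguished {L E M : C} {i : L ⟶ E} {p : E ⟶ M} {ε : M ⟶ L⟦(1 : ℤ)⟧}
    (H : Triangle.mk (i⟦(1 : ℤ)⟧') (p⟦(1 : ℤ)⟧') (-ε⟦(1 : ℤ)⟧') ∈ distTriang C) :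
    Triangle.mk i p ε ∈ distTriang C := by
  rw [rotate_distinguished_triangle, rotate_distinguished_triangle, rotate_distinguished_triangle]
  refine isomorphic_distinguished _ H _
    (Triangle.isoMk _ _ (Iso.refl _) (-Iso.refl _) (Iso.refl _) ?_ ?_ ?_)
  · change (-i⟦(1 : ℤ)⟧') ≫ (-𝟙 (E⟦(1 : ℤ)⟧)) = 𝟙 _ ≫ i⟦(1 : ℤ)⟧'
    simp
  · change (-p⟦(1 : ℤ)⟧') ≫ 𝟙 _ = (-𝟙 (E⟦(1 : ℤ)⟧)) ≫ p⟦(1 : ℤ)⟧'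
    simp
  · change (-ε⟦(1 : ℤ)⟧') ≫ (𝟙 (L⟦(1 : ℤ)⟧))⟦(1 : ℤ)⟧' = 𝟙 _ ≫ (-ε⟦(1 : ℤ)⟧')
    simp

variable [IsTriangulated C]

/-- For a triangle `L → E → M → Σ L` with third morphism `ε`, the index pairings satisfy
`f(L) + f(M) - f(E) = f(Σ Z) + f(Z)`, where `F Σ Z` is the image of `F ε`. The projection of `F M`
onto the image is induced by some `c : M ⟶ Σ Z`. Let `K` be its cocone, and `P` the cocone of
the composite `E ⟶ M ⟶ Σ Z`. The triangles `K → M → Σ Z`, `Z → P → E` and, by the octahedral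
axiom, `L → P → K` all have third morphisms killed by `T`. -/
theorem friezeHom_add_eq {L E M Z : C} {i : L ⟶ E} {p : E ⟶ M} {ε : M ⟶ L⟦(1 : ℤ)⟧}
    (H : Triangle.mk i p ε ∈ distTriang C) (c : M ⟶ Z⟦(1 : ℤ)⟧)
    (hc : ∀ t : T ⟶ Z⟦(1 : ℤ)⟧, ∃ s : T ⟶ M, s ≫ c = t)
    (hcε : ∀ t : T ⟶ M, t ≫ c = 0 ↔ t ≫ ε = 0) :
    friezeHom k hT L + friezeHom k hT M =
      friezeHom k hT E + (friezeHom k hT (Z⟦(1 : ℤ)⟧) + friezeHom k hT Z) := by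
  obtain ⟨K, κ, δ, hK⟩ := distinguished_cocone_triangle₁ c
  obtain ⟨P, d, j, hP⟩ := distinguished_cocone_triangle₂ (p ≫ c)
  have o := (IsTriangulated.octahedron_axiom (rfl : p ≫ c = p ≫ c) (rot_of_distTriang _ H)
    (rot_of_distTriang _ hK)
    (rot_of_distTriang _ (rot_of_distTriang _ hP))).some
  obtain ⟨m₁, hm₁⟩ : ∃ m₁ : L ⟶ P, m₁⟦(1 : ℤ)⟧' = o.m₁ :=
    (shiftFunctor C (1 : ℤ)).map_surjective o.m₁
  obtain ⟨m₃, hm₃⟩ : ∃ m₃ : P ⟶ K, m₃⟦(1 : ℤ)⟧' = o.m₃ :=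
    (shiftFunctor C (1 : ℤ)).map_surjective o.m₃
  have h1 : Triangle.mk m₁ m₃ (κ ≫ ε) ∈ distTriang C := by
    apply unshift_distinguished
    have h := o.mem
    rw [← hm₁, ← hm₃] at h
    have h' : -(κ ≫ ε)⟦(1 : ℤ)⟧' = (-κ⟦(1 : ℤ)⟧') ≫ ε⟦(1 : ℤ)⟧' := by simp
    rw [h']
    exact h
  have e1 := friezeHom_add_of_killed k hT hK fun t => by
    obtain ⟨s, rfl⟩ := hc t
    rw [Category.assoc, dist_comp₂₃ hK, comp_zero]
  have e2 := friezeHom_add_of_killed k hT h1 fun t => by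
    rw [← Category.assoc, ← hcε, Category.assoc, dist_comp₁₂ hK, comp_zero]
  have e3 := friezeHom_add_of_killed k hT hP fun t => by
    rw [← Category.assoc, hcε, Category.assoc, dist_comp₂₃ H, comp_zero]
  rw [e1, ← add_assoc, ← e2, e3]
  abel

end Additivity

/-! ### Positivity on simple modules -/

section Positivity

variable {k : Type w} [Field k] {A : Type v} [Ring A] [Algebra k A]

/-- A homomorphism on the Grothendieck group that is nonnegative on the simple modules is
nonnegative on all modules: induction on a composition series. -/
theorem K0Mod.nonneg_of_simple {g : K0Mod k A →+ ℤ}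
    (hg : ∀ S : FDMod k A, IsSimpleModule A S.obj → 0 ≤ g (K0Mod.cls S)) (N : FDMod k A) :
    0 ≤ g (K0Mod.cls N) := by
  have key : ∀ (M : Type v) [AddCommGroup M] [Module A M], IsFiniteLength A M →
      ∀ hM : finDim k A (ModuleCat.of A M), 0 ≤ g (K0Mod.cls ⟨ModuleCat.of A M, hM⟩) := by
    intro M _ _ h
    induction h with
    | of_subsingleton =>
      rename_i M _ _ _
      intro hM
      let Z : FDMod k A := ⟨ModuleCat.of A M, hM⟩
      have hZ : IsZero Z.obj := ModuleCat.isZero_of_subsingleton _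
      have hS : (ShortComplex.mk (0 : Z.obj ⟶ Z.obj) (0 : Z.obj ⟶ Z.obj) comp_zero).ShortExact :=
        { exact := ShortComplex.exact_of_isZero_X₂ _ hZ
          mono_f := ⟨fun _ _ _ => hZ.eq_of_tgt _ _⟩
          epi_g := ⟨fun _ _ _ => hZ.eq_of_src _ _⟩ }
      have h0 := congrArg g (K0Mod.cls_eq_add hS)
      rw [map_add] at h0
      change 0 ≤ g (K0Mod.cls Z)
      omega
    | of_simple_quotient h ih =>
      rename_i M _ _ P _
      intro hM
      have hi : Mono (ModuleCat.ofHom P.subtype) :=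
        (ModuleCat.mono_iff_injective _).2 P.injective_subtype
      have hq : Epi (ModuleCat.ofHom P.mkQ) :=
        (ModuleCat.epi_iff_surjective _).2 P.mkQ_surjective
      let M₁ : FDMod k A := ⟨ModuleCat.of A P, finDim_of_mono (ModuleCat.ofHom P.subtype) hM⟩
      let M₂ : FDMod k A := ⟨ModuleCat.of A M, hM⟩
      let M₃ : FDMod k A := ⟨ModuleCat.of A (M ⧸ P), finDim_of_epi (ModuleCat.ofHom P.mkQ) hM⟩
      have h0 : (ModuleCat.ofHom P.subtype : M₁.obj ⟶ M₂.obj) ≫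
          (ModuleCat.ofHom P.mkQ : M₂.obj ⟶ M₃.obj) = 0 := by
        apply ModuleCat.hom_ext
        apply LinearMap.ext
        intro x
        exact (Submodule.Quotient.mk_eq_zero P).2 x.2
      have hS : (ShortComplex.mk (ModuleCat.ofHom P.subtype : M₁.obj ⟶ M₂.obj)
          (ModuleCat.ofHom P.mkQ : M₂.obj ⟶ M₃.obj) h0).ShortExact :=
        { exact := by
            rw [ShortComplex.moduleCat_exact_iff]
            intro x hx
            exact ⟨⟨x, (Submodule.Quotient.mk_eq_zero P).1 hx⟩, rfl⟩
          mono_f := hi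
          epi_g := hq }
      have hcls := K0Mod.cls_eq_add (M₁ := M₁) (M₂ := M₂) (M₃ := M₃) hS
      change 0 ≤ g (K0Mod.cls M₂)
      rw [hcls, map_add]
      exact add_nonneg (ih M₁.property) (hg M₃ ‹_›)
  have hN : Module.Finite k N.obj := N.property
  have h1 : IsNoetherian A N.obj := isNoetherian_of_tower k inferInstance
  have h2 : IsArtinian A N.obj := isArtinian_of_tower k inferInstance
  exact key N.obj (isFiniteLength_iff_isNoetherian_isArtinian.2 ⟨h1, h2⟩) N.property

end Positivity

section Triangles

variable (k : Type w) [Field k] {C : Type u} [Category.{v} C] [Preadditive C] [Linear k C]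
  [HasZeroObject C] [HasShift C ℤ] [∀ n : ℤ, (shiftFunctor C n).Additive]
  [∀ n : ℤ, (shiftFunctor C n).Linear k]
  [Pretriangulated C] [IsTriangulated C] [HomFinite k C] {T : C} (hT : IsClusterTilting T)
  (hCY : IsTwoCalabiYau k C)
  {β : K0Mod k (End T)ᵐᵒᵖ →+ K0Mod k (End T)ᵐᵒᵖ →+ ℤ}
  (hβ : ∀ M N : FDMod k (End T)ᵐᵒᵖ, β (K0Mod.cls M) (K0Mod.cls N) = eulerAnti k M.obj N.obj)

include hCY hβ

/-- For a triangle `L → E → M → Σ L` with third morphism `ε`, the defect of additivity of the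
index pairing with `m` is `⟨im F ε, m⟩ₐ`. -/
theorem friezeHom_add_eq_form {L E M : C} {i : L ⟶ E} {p : E ⟶ M} {ε : M ⟶ L⟦(1 : ℤ)⟧}
    (H : Triangle.mk i p ε ∈ distTriang C) (N : FDMod k (End T)ᵐᵒᵖ)
    (π : (homFunctor T).obj M ⟶ N.obj) [Epi π] (hπ : ∀ t : T ⟶ M, π.hom t = 0 ↔ t ≫ ε = 0) :
    friezeHom k hT L + friezeHom k hT M = friezeHom k hT E + β (K0Mod.cls N) := by
  obtain ⟨Z, ⟨e⟩⟩ := exists_homFunctor_shift_iso k hT N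
  obtain ⟨c, hc⟩ := homFunctor_map_surjective k hT (π ≫ e.hom)
  have hcom : ∀ t : T ⟶ M, t ≫ c = e.hom.hom (π.hom t) := fun t => congrArg (fun φ => φ.hom t) hc
  have hN : β (K0Mod.cls N) = friezeHom k hT (Z⟦(1 : ℤ)⟧) + friezeHom k hT Z := by
    apply K0Mod.hom_ext
    intro N'
    rw [hβ, eulerAnti_eq_friezeHom k hT hCY e]
  rw [hN]
  apply friezeHom_add_eq k hT H c
  · have : Epi ((homFunctor T).map c) := by
      rw [hc]
      infer_instance
    exact (ModuleCat.epi_iff_surjective _).1 this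
  · intro t
    rw [← hπ, hcom]
    constructor
    · intro h
      exact (ModuleCat.mono_iff_injective e.hom).1 inferInstance (h.trans (map_zero e.hom.hom).symm)
    · intro h
      rw [h]
      exact map_zero e.hom.hom

theorem friezeHom_le_add {L E M : C} {i : L ⟶ E} {p : E ⟶ M} {ε : M ⟶ L⟦(1 : ℤ)⟧}
    (H : Triangle.mk i p ε ∈ distTriang C) {m : K0Mod k (End T)ᵐᵒᵖ}
    (hm : ∀ N : FDMod k (End T)ᵐᵒᵖ, 0 ≤ β (K0Mod.cls N) m) :
    friezeHom k hT E m ≤ friezeHom k hT L m + friezeHom k hT M m := by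
  have hM := homFunctor_finite k T M
  let φ := ((homFunctor T).map ε).hom
  have hπ : Epi (ModuleCat.ofHom φ.rangeRestrict) :=
    (ModuleCat.epi_iff_surjective _).2 φ.surjective_rangeRestrict
  let N : FDMod k (End T)ᵐᵒᵖ := ⟨ModuleCat.of (End T)ᵐᵒᵖ (LinearMap.range φ),
    finDim_of_epi (ModuleCat.ofHom φ.rangeRestrict) hM⟩
  let π : (homFunctor T).obj M ⟶ N.obj := ModuleCat.ofHom φ.rangeRestrict
  have : Epi π := hπ
  have h := friezeHom_add_eq_form k hT hCY hβ H N π fun t => Subtype.ext_iff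
  have h' := congrArg (fun χ => χ m) h
  simp only [AddMonoidHom.add_apply] at h'
  rw [h']
  exact le_add_of_nonneg_right (hm N)

/-- If `⟨N, m⟩ₐ ≥ 0` for all modules `N`, then `f_{T,m}` is a tropical frieze. In an exchange pair
the spaces of morphisms `L ⟶ Σ M` and `M ⟶ Σ L` killed by `T` are orthogonal complements of each
other in one-dimensional spaces, so one of the two triangles is additive. -/
theorem isTropicalFrieze_of_nonneg {m : K0Mod k (End T)ᵐᵒᵖ}
    (hm : ∀ N : FDMod k (End T)ᵐᵒᵖ, 0 ≤ β (K0Mod.cls N) m) :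
    IsTropicalFrieze k (friezeFun k hT m) where
  iso X Y := fun ⟨e⟩ => by rw [friezeFun_eq, friezeFun_eq, friezeHom_congr k hT e]
  add X Y := by
    rw [friezeFun_eq, friezeFun_eq, friezeFun_eq, friezeHom_biprod, AddMonoidHom.add_apply]
  exchange L M h1 E E' a b c a' b' c' H hc H' hc' := by
    simp only [friezeFun_eq]
    have l := friezeHom_le_add k hT hCY hβ H hm
    have l' := friezeHom_le_add k hT hCY hβ H' hm
    have hsum := finrank_killed_add k hT hCY L M
    have h2 := finrank_hom_shift_comm k hCY L M
    have key : (∀ t : T ⟶ L, t ≫ c' = 0) ∨ (∀ t : T ⟶ M, t ≫ c = 0) := by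
      have hd : Module.finrank k (killed k T L (M⟦(1 : ℤ)⟧)) = Module.finrank k (L ⟶ M⟦(1 : ℤ)⟧) ∨
          Module.finrank k (killed k T M (L⟦(1 : ℤ)⟧)) = Module.finrank k (M ⟶ L⟦(1 : ℤ)⟧) := by
        omega
      refine hd.imp (fun h => ?_) fun h => ?_
      · exact mem_killed.1
          (Submodule.eq_top_of_finrank_eq h ▸ Submodule.mem_top : c' ∈ killed k T _ _)
      · exact mem_killed.1
          (Submodule.eq_top_of_finrank_eq h ▸ Submodule.mem_top : c ∈ killed k T _ _)
    rcases key with h | h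
    · have e := friezeHom_add_of_killed k hT H' h
      rw [e, AddMonoidHom.add_apply] at l' ⊢
      rw [add_comm, max_eq_right]
      linarith
    · have e := friezeHom_add_of_killed k hT H h
      rw [e, AddMonoidHom.add_apply] at l ⊢
      rw [max_eq_left]
      linarith

end Triangles

/-! ### Endomorphism algebras of indecomposable objects -/

section LocalAlgebra

variable {k : Type w} [Field k] [IsAlgClosed k] {A : Type*} [Ring A] [Algebra k A]
  [Module.Finite k A]

open Polynomial in
/-- In a finite-dimensional algebra without nontrivial idempotents over an algebraically closed
field, every element is the sum of a scalar and a nilpotent element: if `λ` is a root of the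
minimal polynomial `(X - λ)ⁿ q` with `q(λ) ≠ 0`, the idempotent attached to this factorization is
`0` or `1`. -/
theorem exists_isNilpotent_sub_algebraMap [Nontrivial A]
    (hA : ∀ e : A, e * e = e → e = 0 ∨ e = 1) (a : A) :
    ∃ μ : k, IsNilpotent (a - algebraMap k A μ) := by
  have ha : IsIntegral k a := Algebra.IsIntegral.isIntegral a
  obtain ⟨μ, hμ⟩ := IsAlgClosed.exists_root (minpoly k a) (minpoly.degree_pos ha).ne'
  refine ⟨μ, ?_⟩
  obtain ⟨g, hg, hdvd⟩ := Polynomial.exists_eq_pow_rootMultiplicity_mul_and_not_dvd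
    (minpoly k a) (minpoly.ne_zero ha) μ
  set n := (minpoly k a).rootMultiplicity μ
  have hcop : IsCoprime ((X - C μ) ^ n) g :=
    ((Polynomial.irreducible_X_sub_C μ).coprime_iff_not_dvd.2 hdvd).pow_left
  obtain ⟨x, y, hxy⟩ := hcop
  have hp : aeval a ((X - C μ) ^ n) * aeval a g = 0 := by
    rw [← map_mul, ← hg, minpoly.aeval]
  have h1 : aeval a x * aeval a ((X - C μ) ^ n) + aeval a y * aeval a g = 1 := by
    rw [← map_mul, ← map_mul, ← map_add, hxy, map_one]
  have hc : ∀ s t : k[X], aeval a s * aeval a t = aeval a t * aeval a s := fun s t => by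
    rw [← map_mul, mul_comm, map_mul]
  rcases hA (aeval a y * aeval a g) (by
    have h2 : aeval a y * aeval a g * (aeval a x * aeval a ((X - C μ) ^ n)) = 0 := by
      simp only [← map_mul] at hp ⊢
      rw [show y * g * (x * (X - C μ) ^ n) = y * x * ((X - C μ) ^ n * g) by ring, map_mul, hp,
        mul_zero]
    have h3 := congrArg (aeval a y * aeval a g * ·) h1
    simpa only [mul_add, h2, zero_add, mul_one] using h3) with h0 | h0
  · exfalso
    rw [h0, add_zero] at h1
    have h2 : aeval a g = 0 := by
      rw [← one_mul (aeval a g), ← h1, mul_assoc, hp, mul_zero]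
    exact hdvd ((Polynomial.dvd_iff_isRoot.2 hμ).trans (minpoly.dvd k a h2))
  · refine ⟨n, ?_⟩
    have h2 : aeval a ((X - C μ) ^ n) = 0 := by
      rw [← mul_one (aeval a _), ← h0, ← mul_assoc, hc _ y, mul_assoc, hp, mul_zero]
    simpa using h2

include k in
/-- The nilpotent elements of such an algebra are stable under multiplication. -/
theorem isNilpotent_mul_of_isNilpotent [Nontrivial A]
    (hA : ∀ e : A, e * e = e → e = 0 ∨ e = 1) {y : A} (hy : IsNilpotent y) (b : A) :
    IsNilpotent (y * b) := by
  obtain ⟨μ, hμ⟩ := exists_isNilpotent_sub_algebraMap (k := k) hA (y * b)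
  rcases eq_or_ne μ 0 with rfl | h
  · simpa using hμ
  · exfalso
    have hu : IsUnit (y * b) := by
      have h1 : IsUnit (algebraMap k A μ) := (IsUnit.mk0 μ h).map (algebraMap k A)
      have h2 := hμ.isUnit_add_right_of_commute h1 (Algebra.commutes μ _).symm
      simpa using h2
    obtain ⟨z, hz⟩ := hu.exists_right_inv
    obtain ⟨n, hn⟩ := hy
    have h3 := pow_mul_pow_eq_one n (by rwa [mul_assoc] at hz : y * (b * z) = 1)
    rw [hn, zero_mul] at h3
    exact zero_ne_one h3

end LocalAlgebra

section Indecomposable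

variable {C : Type u} [Category.{v} C] [Preadditive C] [HasBinaryBiproducts C]
  [IsIdempotentComplete C]

theorem idempotent_eq_of_indecomposable {P : C} (hP : Indecomposable P) (e : P ⟶ P)
    (he : e ≫ e = e) : e = 0 ∨ e = 𝟙 P := by
  obtain ⟨Y, i, r, h1, h2⟩ := IsIdempotentComplete.idempotents_split P e he
  obtain ⟨Y', i', r', h1', h2'⟩ := IsIdempotentComplete.idempotents_split P (𝟙 P - e)
    (by simp [he])
  have h3 : i ≫ r' = 0 := by
    have h : i ≫ r' = (i ≫ r) ≫ i ≫ (r' ≫ i') ≫ r' := by simp [h1, h1']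
    rw [h, h2', Category.assoc i r, reassoc_of% h2]
    simp [reassoc_of% he]
  have h4 : i' ≫ r = 0 := by
    have h : i' ≫ r = (i' ≫ r') ≫ i' ≫ (r ≫ i) ≫ r := by simp [h1, h1']
    rw [h, h2, Category.assoc i' r', reassoc_of% h2']
    simp [reassoc_of% he]
  let φ : P ≅ Y ⊞ Y' :=
    { hom := biprod.lift r r'
      inv := biprod.desc i i'
      hom_inv_id := by rw [biprod.lift_desc, h2, h2']; abel
      inv_hom_id := by
        apply biprod.hom_ext' <;> apply biprod.hom_ext <;> simp [h1, h1', h3, h4] }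
  rcases hP.2 Y Y' φ with h | h
  · left
    rw [← h2, h.eq_of_tgt r 0, zero_comp]
  · right
    rw [← sub_eq_zero, ← neg_sub, ← h2', h.eq_of_tgt r' 0, zero_comp, neg_zero]

variable (k : Type w) [Field k] [IsAlgClosed k] [Linear k C]

/-- If every nonzero morphism `P ⟶ X` generates the `End P`-module `C(P, X)`, with `P`
indecomposable, then this module is simple, hence annihilated by the nilpotent endomorphisms and
one-dimensional. -/
theorem finrank_hom_eq_one_of_indecomposable {P X : C} (hP : Indecomposable P)
    [Module.Finite k (End P)] {g : P ⟶ X} (hg : g ≠ 0)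
    (hgen : ∀ g' : P ⟶ X, g' ≠ 0 → ∀ g'' : P ⟶ X, ∃ a : P ⟶ P, a ≫ g' = g'') :
    Module.finrank k (P ⟶ X) = 1 := by
  have : Nontrivial (End P) := ⟨⟨0, 1, fun h => hP.1 ((IsZero.iff_id_eq_zero P).2 h.symm)⟩⟩
  have hA : ∀ e : End P, e * e = e → e = 0 ∨ e = 1 := idempotent_eq_of_indecomposable hP
  have hnil : ∀ (x : End P), IsNilpotent x → (x : P ⟶ P) ≫ g = g → False := by
    rintro x ⟨n, hn⟩ hx
    have h1 : ∀ n : ℕ, (show P ⟶ P from x ^ n) ≫ g = g := by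
      intro n
      induction n with
      | zero => exact Category.id_comp g
      | succ n ih =>
        have h2 : (show P ⟶ P from x ^ (n + 1)) = (show P ⟶ P from x) ≫ (show P ⟶ P from x ^ n) :=
          pow_succ x n
        rw [h2, Category.assoc, ih, hx]
    have h2 := h1 n
    rw [hn] at h2
    exact hg (h2.symm.trans zero_comp)
  rw [finrank_eq_one_iff']
  refine ⟨g, hg, fun g' => ?_⟩
  obtain ⟨a, rfl⟩ := hgen g hg g'
  obtain ⟨μ, hμ⟩ := exists_isNilpotent_sub_algebraMap (k := k) hA (a : End P)
  refine ⟨μ, ?_⟩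
  by_contra hne
  obtain ⟨y, hy⟩ : ∃ y : P ⟶ P, y = (show End P from a) - algebraMap k (End P) μ := ⟨_, rfl⟩
  have hy' : y = a - μ • 𝟙 P := hy
  have h1 : y ≫ g ≠ 0 := by
    rw [hy', Preadditive.sub_comp, Linear.smul_comp, Category.id_comp, sub_ne_zero]
    exact fun h => hne h.symm
  obtain ⟨b, hb⟩ := hgen _ h1 g
  rw [← hy] at hμ
  refine hnil (show End P from b ≫ y) ?_ ((Category.assoc b y g).trans hb)
  exact isNilpotent_mul_of_isNilpotent (k := k) hA hμ b

end Indecomposable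

/-! ### Simple modules and exchange pairs -/

section Simple

variable (k : Type w) [Field k] {C : Type u} [Category.{v} C] [Preadditive C] [Linear k C]
  [HasZeroObject C] [HasShift C ℤ] [∀ n : ℤ, (shiftFunctor C n).Additive]
  [Pretriangulated C] {T : C} (hT : IsClusterTilting T)

include hT in
/-- A nonzero morphism into `X` from `T` yields one from an indecomposable summand of `T`. -/
theorem IsClusterTilting.exists_indecomposable {X : C} {t : T ⟶ X} (ht : t ≠ 0) :
    ∃ P : C, addClosure T P ∧ Indecomposable P ∧ ∃ g : P ⟶ X, g ≠ 0 := by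
  obtain ⟨n, S, hS, -, ⟨e⟩⟩ := hT.basic
  obtain ⟨j, hj⟩ : ∃ j, biproduct.ι S j ≫ e.inv ≫ t ≠ 0 := by
    by_contra! h
    apply ht
    rw [← cancel_epi e.inv, comp_zero]
    apply biproduct.hom_ext'
    intro j
    rw [h, comp_zero]
  obtain ⟨N, ⟨ρ⟩⟩ := addClosure_self T
  exact ⟨S j, ⟨N, ⟨Retract.trans
    { i := biproduct.ι S j ≫ e.inv, r := e.hom ≫ biproduct.π S j } ρ⟩⟩, hS j, _, hj⟩

/-- A nonzero morphism `P ⟶ X` from an object of `add T` to an object with simple image `F X` is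
mapped by `F` to an epimorphism. -/
theorem epi_homFunctor_map_of_simple {P X : C} (hP : addClosure T P)
    (hX : IsSimpleModule (End T)ᵐᵒᵖ ((homFunctor T).obj X)) {g : P ⟶ X} (hg : g ≠ 0) :
    Epi ((homFunctor T).map g) := by
  rw [ModuleCat.epi_iff_surjective]
  apply (LinearMap.surjective_or_eq_zero ((homFunctor T).map g).hom).resolve_right
  intro h
  apply hg
  apply (homFunctor_map_bijective_of_addClosure hP X).1
  change (homFunctor T).map g = (homFunctor T).map 0
  rw [Functor.map_zero]
  exact ModuleCat.hom_ext h

theorem finrank_hom_eq_one_of_simple [IsAlgClosed k] [IsIdempotentComplete C] [HomFinite k C]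
    {P X : C} (hP : addClosure T P) (hP' : Indecomposable P)
    (hX : IsSimpleModule (End T)ᵐᵒᵖ ((homFunctor T).obj X)) {g : P ⟶ X} (hg : g ≠ 0) :
    Module.finrank k (P ⟶ X) = 1 := by
  have : Module.Finite k (End P) := finite_hom_of_homFinite k P P
  refine finrank_hom_eq_one_of_indecomposable k hP' hg fun g' hg' g'' => ?_
  have := homFunctor_projective hP
  have := epi_homFunctor_map_of_simple hP hX hg'
  obtain ⟨a, ha⟩ := (homFunctor_map_bijective_of_addClosure hP P).2
    (Projective.factorThru ((homFunctor T).map g'') ((homFunctor T).map g'))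
  refine ⟨a, (homFunctor_map_bijective_of_addClosure hP X).1 ?_⟩
  change (homFunctor T).map (a ≫ g') = (homFunctor T).map g''
  rw [Functor.map_comp, show (homFunctor T).map a = _ from ha, Projective.factorThru_comp]

variable [∀ n : ℤ, (shiftFunctor C n).Linear k] [IsTriangulated C] [IsAlgClosed k]
  [IsIdempotentComplete C] [HomFinite k C] (hCY : IsTwoCalabiYau k C)
  {β : K0Mod k (End T)ᵐᵒᵖ →+ K0Mod k (End T)ᵐᵒᵖ →+ ℤ}
  (hβ : ∀ M N : FDMod k (End T)ᵐᵒᵖ, β (K0Mod.cls M) (K0Mod.cls N) = eulerAnti k M.obj N.obj)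

include hCY hβ

/-- If `f_{T,m}` is a tropical frieze, then `⟨S, m⟩ₐ ≥ 0` for each simple module `S`. With
`S = F Σ Z` and `P` the indecomposable summand of `T` for which `F P` covers `S`, the objects
`Z` and `P` form an exchange pair and `S` is the image of `F ε` for a nonzero `ε : P ⟶ Σ Z`, so
that `⟨S, m⟩ₐ` is the defect of additivity on the triangle of `ε`. -/
theorem nonneg_of_isTropicalFrieze {m : K0Mod k (End T)ᵐᵒᵖ}
    (hf : IsTropicalFrieze k (friezeFun k hT m)) (S : FDMod k (End T)ᵐᵒᵖ)
    (hS : IsSimpleModule (End T)ᵐᵒᵖ S.obj) : 0 ≤ β (K0Mod.cls S) m := by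
  obtain ⟨Z, ⟨e⟩⟩ := exists_homFunctor_shift_iso k hT S
  have hX : IsSimpleModule (End T)ᵐᵒᵖ ((homFunctor T).obj (Z⟦(1 : ℤ)⟧)) :=
    IsSimpleModule.congr e.symm.toLinearEquiv
  obtain ⟨t, ht⟩ := @exists_ne _ (IsSimpleModule.nontrivial (End T)ᵐᵒᵖ _)
    (0 : (homFunctor T).obj (Z⟦(1 : ℤ)⟧))
  obtain ⟨P, hP, hP', ε, hε⟩ := hT.exists_indecomposable (t := t) ht
  have h1 := finrank_hom_eq_one_of_simple k hP hP' hX hε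
  have h2 : Module.finrank k (Z ⟶ P⟦(1 : ℤ)⟧) = 1 :=
    (finrank_hom_shift_comm k hCY Z P).trans h1
  obtain ⟨ε', hε', -⟩ := finrank_eq_one_iff'.1 h2
  obtain ⟨E, a, b, H⟩ := distinguished_cocone_triangle₂ ε
  obtain ⟨E', a', b', H'⟩ := distinguished_cocone_triangle₂ ε'
  have hex := hf.exchange Z P h2 E E' a b ε a' b' ε' H hε H' hε'
  have := epi_homFunctor_map_of_simple hP hX hε
  have hdef := friezeHom_add_eq_form k hT hCY hβ H S ((homFunctor T).map ε ≫ e.inv) fun t => by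
    have h3 : ((homFunctor T).map ε ≫ e.inv).hom t = e.inv.hom (t ≫ ε) := rfl
    rw [h3]
    constructor
    · intro h
      exact (ModuleCat.mono_iff_injective e.inv).1 inferInstance (h.trans (map_zero e.inv.hom).symm)
    · intro h
      rw [h]
      exact map_zero e.inv.hom
  have hdef' := congrArg (fun χ => χ m) hdef
  simp only [AddMonoidHom.add_apply] at hdef'
  simp only [friezeFun_eq] at hex
  have := le_max_left (friezeHom k hT E m) (friezeHom k hT E' m)
  omega

end Simple

end TropFrieze

theorem theorem2 {k : Type w} [Field k] [IsAlgClosed k]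
    {C : Type u} [Category.{v} C] [Preadditive C] [Linear k C] [HasZeroObject C] [HasShift C ℤ]
    [∀ n : ℤ, (shiftFunctor C n).Additive] [∀ n : ℤ, (shiftFunctor C n).Linear k]
    [Pretriangulated C] [IsTriangulated C] [IsIdempotentComplete C]
    [TropFrieze.HomFinite k C] (hCY : TropFrieze.IsTwoCalabiYau k C)
    (T : C) (hT : TropFrieze.IsClusterTilting T) :
    -- the antisymmetrized Euler form descends to the Grothendieck group
    ∃ β : TropFrieze.K0Mod k (End T)ᵐᵒᵖ →+ TropFrieze.K0Mod k (End T)ᵐᵒᵖ →+ ℤ,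
      (∀ X Y : TropFrieze.FDMod k (End T)ᵐᵒᵖ,
        β (TropFrieze.K0Mod.cls X) (TropFrieze.K0Mod.cls Y) =
          TropFrieze.eulerAnti k X.obj Y.obj) ∧
      ∀ m : TropFrieze.K0Mod k (End T)ᵐᵒᵖ,
        -- the condition is sufficient
        ((∀ S : TropFrieze.FDMod k (End T)ᵐᵒᵖ, IsSimpleModule (End T)ᵐᵒᵖ S.obj →
            0 ≤ β (TropFrieze.K0Mod.cls S) m) →
          TropFrieze.IsTropicalFrieze k (TropFrieze.friezeFun k hT m)) ∧
        -- the condition is necessary for cluster categories of Dynkin quivers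
        (∀ (Q : Type q) [Quiver.{r} Q], TropFrieze.IsDynkinQuiver Q →
          TropFrieze.IsClusterCategory k Q C →
          TropFrieze.IsTropicalFrieze k (TropFrieze.friezeFun k hT m) →
          ∀ S : TropFrieze.FDMod k (End T)ᵐᵒᵖ, IsSimpleModule (End T)ᵐᵒᵖ S.obj →
            0 ≤ β (TropFrieze.K0Mod.cls S) m) := by
  obtain ⟨β, hβ⟩ := TropFrieze.exists_eulerAntiForm k hT hCY
  refine ⟨β, hβ, fun m => ⟨fun h => ?_, fun _ _ _ _ hf S hS =>
    TropFrieze.nonneg_of_isTropicalFrieze k hT hCY hβ hf S hS⟩⟩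
  exact TropFrieze.isTropicalFrieze_of_nonneg k hT hCY hβ
    (TropFrieze.K0Mod.nonneg_of_simple (g := β.flip m) h)
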